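/- Theorem (Propagation of chaos). For integers $N,M\ge 1$ let $\Omega=\{0,1\}^{\{1,\dots,N\}}\times\{0,\dots,M\}^2$, with elements $\omega=(\eta,n_-,n_+)$, and consider the Markov process on $\Omega$ with generator $$\mathbf L f(\omega)=\tfrac12\sum_{x=1}^{N-1}[f(\omega^{x,x+1})-f(\omega)]+c_N(\omega)[f(\omega^N)-f(\omega)]+c_1(\omega)[f(\omega^1)-f(\omega)],$$ where $\omega^{x,x+1}$ is $\omega$ with $\eta(x)$ and $\eta(x+1)$ exchanged, $c_N(\omega)=\tfrac12(1-\tfrac{n_+}{M})\eta(N)+\tfrac12\tfrac{n_+}{M}(1-\eta(N))$, and $\omega^N$ is obtained from $\omega$ by replacing $\eta(N)$ by $1-\eta(N)$ and $n_+$ by $n_++1$ if $\eta(N)=1$ and by $n_+-1$ if $\eta(N)=0$; $c_1$ and $\omega^1$ are defined in the same way from $\eta(1)$ and $n_-$. Let $\alpha>0$ and $M=\lfloor N^{1+\alpha}\rfloor$. Let $v_{0,\pm}\in[0,1]$ and let $u_0:(0,1]\to[0,1]$ be continuous on $(0,1)$. For every $N$ let an initial law on $\Omega$ be given such that, at time $0$,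 $n_\pm/M\to v_{0,\pm}$ in probability as $N\to\infty$ and $\mathbf E^N[\eta(x,0)]=u_0(x/N)$ for all $x\in\{1,\dots,N\}$; $\mathbf E^N$ denotes the expectation for the process with this initial law. Write $$K_N(x,y;s)=\mathbf E^N[\eta(x,s)\eta(y,s)]-\mathbf E^N[\eta(x,s)]\,\mathbf E^N[\eta(y,s)].$$ Let $\alpha'\in[0,\alpha)$ and $t>0$. Then: (i) for any distinct sites $x_1,x_2\in\{1,2,\dots\}$ (not depending on $N$), $\lim_{N\to\infty}|K_N(x_1,x_2;N^{2+\alpha'}t)|=0$; (ii) if $\alpha'>0$, or if the initial laws satisfy $\lim_{N\to\infty}\sup_{1\le x\ne y\le N}|K_N(x,y;0)|=0$ (for instance, if the $\eta(x,0)$ are independent), then the limit holds also for sites that depend on $N$, uniformly: $\lim_{N\to\infty}\sup_{1\le x\ne y\le N}|K_N(x,y;N^{2+\alpha'}t)|=0$. -/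

import Mathlib

open Filter Topology

noncomputable section

namespace ReservoirSSEP

/-- The sites of the channel `{1, …, N}`. -/
abbrev Site (N : ℕ) : Type := {x : ℕ // x ∈ Finset.Icc 1 N}

/-- The state space `{0,1}^{1,…,N} × {0,…,M} × {0,…,M}`; an element is `(η, n₋, n₊)`. -/
abbrev Config (N M : ℕ) : Type := (Site N → Bool) × Fin (M + 1) × Fin (M + 1)

variable {N M : ℕ}

/-- Occupation number (0 or 1) as a real number. -/
def occ (b : Bool) : ℝ := if b then 1 else 0

/-- The occupation variable `η(x)` of the site `x` (and `0` if `x` is not in `{1, …, N}`). -/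
def eta (x : ℕ) (ω : Config N M) : ℝ :=
  if h : x ∈ Finset.Icc 1 N then occ (ω.1 ⟨x, h⟩) else 0

/-- The density `n₋ / M` of the left reservoir. -/
def leftDensity (ω : Config N M) : ℝ := (ω.2.1 : ℕ) / (M : ℝ)

/-- The density `n₊ / M` of the right reservoir. -/
def rightDensity (ω : Config N M) : ℝ := (ω.2.2 : ℕ) / (M : ℝ)

/-- The configuration in which the occupations of the sites `x` and `y` are exchanged. -/
def exchange (ω : Config N M) (x y : Site N) : Config N M :=
  (ω.1 ∘ Equiv.swap x y, ω.2)

/-- Number of particles of a reservoir with `n` particles after an exchange with a channel site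
whose occupation before the exchange is `b`: a particle enters the reservoir if `b = 1` and leaves
it if `b = 0`. The truncations (at `n = M`, `b = 1`, and at `n = 0`, `b = 0`) are only met for moves
of rate zero. -/
def reservoirMove (b : Bool) (n : Fin (M + 1)) : Fin (M + 1) :=
  if b then ⟨min ((n : ℕ) + 1) M, by omega⟩ else ⟨(n : ℕ) - 1, by omega⟩

/-- Exchange between the channel site `x` and the left reservoir. -/
def leftMove (ω : Config N M) (x : Site N) : Config N M :=
  (Function.update ω.1 x (!(ω.1 x)), reservoirMove (ω.1 x) ω.2.1, ω.2.2)

/-- Exchange between the channel site `x` and the right reservoir. -/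
def rightMove (ω : Config N M) (x : Site N) : Config N M :=
  (Function.update ω.1 x (!(ω.1 x)), ω.2.1, reservoirMove (ω.1 x) ω.2.2)

/-- The rate of the exchange between a site with occupation `e` and a reservoir of density `d`. -/
def boundaryRate (e d : ℝ) : ℝ := 1 / 2 * (1 - d) * e + 1 / 2 * d * (1 - e)

/-- The generator: neighbouring sites of the channel exchange their occupations at rate `1/2`, and
the sites `1` and `N` exchange particles with the left and with the right reservoir. -/
def genFun (f : Config N M → ℝ) (ω : Config N M) : ℝ :=
  (1 / 2) * (∑ x : Site N, ∑ y : Site N,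
      if (y : ℕ) = (x : ℕ) + 1 then f (exchange ω x y) - f ω else 0)
  + (∑ x : Site N, if (x : ℕ) = N then
      boundaryRate (occ (ω.1 x)) (rightDensity ω) * (f (rightMove ω x) - f ω) else 0)
  + (∑ x : Site N, if (x : ℕ) = 1 then
      boundaryRate (occ (ω.1 x)) (leftDensity ω) * (f (leftMove ω x) - f ω) else 0)

/-- The generator as a linear operator on the functions on the (finite) state space. -/
def gen (N M : ℕ) : (Config N M → ℝ) →ₗ[ℝ] (Config N M → ℝ) where
  toFun := genFun
  map_add' f g := by
    funext ω
    simp only [genFun, Pi.add_apply, Finset.mul_sum]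
    have e1 : ∀ a b c d : ℝ, a + b - (c + d) = (a - c) + (b - d) := by intros; ring
    simp only [e1, mul_add, ite_add_zero, Finset.sum_add_distrib]
    ring
  map_smul' c f := by
    funext ω
    simp only [genFun, Pi.smul_apply, smul_eq_mul, RingHom.id_apply]
    have e1 : ∀ a b : ℝ, c * a - c * b = c * (a - b) := by intros; ring
    have e2 : ∀ a b : ℝ, a * (c * b) = c * (a * b) := by intros; ring
    have e3 : ∀ (p : Prop) [Decidable p] (a : ℝ), (if p then c * a else 0) = c * (if p then a else 0) := by
      intro p _ a; split_ifs <;> simp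
    simp only [e1, e2, e3, ← Finset.mul_sum]
    ring

/-- The Markov semigroup `exp (s L)` at time `s`: `(semigroup N M s f) ω` is the expectation of
`f` at time `s` for the process with generator `L` started at `ω`. -/
def semigroup (N M : ℕ) (s : ℝ) : (Config N M → ℝ) →L[ℝ] (Config N M → ℝ) :=
  NormedSpace.exp (s • LinearMap.toContinuousLinearMap (gen N M))

/-- The expectation of `f` at time `s` for the process with generator `L` and initial law `μ`
(a probability vector on the state space). -/
def expect (μ : Config N M → ℝ) (s : ℝ) (f : Config N M → ℝ) : ℝ :=
  ∑ ω, μ ω * semigroup N M s f ω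

/-- The two-point correlation `E[η(x) η(y)] - E[η(x)] E[η(y)]` at time `s`. -/
def correlation (μ : Config N M → ℝ) (s : ℝ) (x y : ℕ) : ℝ :=
  expect μ s (fun ω => eta x ω * eta y ω) - expect μ s (eta x) * expect μ s (eta y)

open Classical in
/-- The probability of the event `A` under the probability vector `μ`. -/
def prob (μ : Config N M → ℝ) (A : Config N M → Prop) : ℝ := ∑ ω, if A ω then μ ω else 0

/-- The size of a reservoir: the integer part of `N ^ (1 + α)`. -/
def resSize (α : ℝ) (N : ℕ) : ℕ := ⌊(N : ℝ) ^ (1 + α)⌋₊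

/-- The assumption on the initial laws `μ N`: the densities of the reservoirs converge
in probability to `vm` and `vp`, and the mean occupation of the site `x` is `u₀ (x / N)`. -/
structure InitialAssumption (α : ℝ) (u₀ : ℝ → ℝ) (vm vp : ℝ)
    (μ : (N : ℕ) → Config N (resSize α N) → ℝ) : Prop where
  isProb : ∀ N, μ N ∈ stdSimplex ℝ (Config N (resSize α N))
  left_tendsto : ∀ δ > 0,
    Tendsto (fun N => prob (μ N) (fun ω => δ < |leftDensity ω - vm|)) atTop (𝓝 0)
  right_tendsto : ∀ δ > 0,
    Tendsto (fun N => prob (μ N) (fun ω => δ < |rightDensity ω - vp|)) atTop (𝓝 0)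
  profile : ∀ N, ∀ x ∈ Finset.Icc 1 N, ∑ ω, μ N ω * eta x ω = u₀ ((x : ℝ) / N)

/-- The correlations at the times `s N`, for the initial laws `μ N`, of pairs of distinct sites of
the channel tend to `0` as `N → ∞`, uniformly in the pair. -/
def UniformlyDecorrelated (α : ℝ) (μ : (N : ℕ) → Config N (resSize α N) → ℝ) (s : ℕ → ℝ) : Prop :=
  ∀ ε > 0, ∀ᶠ N in atTop, ∀ x ∈ Finset.Icc 1 N, ∀ y ∈ Finset.Icc 1 N, x ≠ y →
    |correlation (μ N) (s N) x y| < ε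

end ReservoirSSEP

end

/-!
Replace each reservoir by `M` vertices, all joined to the adjacent end site of the channel at rate
`1 / (2 M)`. The process is then the image of the symmetric exclusion process on a weighted graph,
in which only the number of particles of each reservoir is recorded: the mean densities `u` follow
the heat flow of the graph, and the truncated correlations `K` follow the flow of two exclusion
walkers with the source `-c(a, b) (u a - u b)²` on the edges `(a, b)`.

By Liggett's comparison of exclusion walkers with independent ones, the source at time `s - r` adds
to `K` at time `s` at most the squared supremum of the heat kernel at time `r`, of order `1 / r` by
the Nash inequality of the channel, times the Dirichlet energy of `u` at time `s - r`, which is of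
order `1 / N` after a time of order `N²`. Integrated, this is of order `log N / N`.

Without the source, `K` at time `s` is an average of initial correlations over the positions of the
two walkers. If one of them sits in a reservoir, the convergence in probability of the density of
the reservoir makes this correlation small. A walker started at `x` is in the channel with
probability at most of order `N / M + x (N + 1 - x) / s`, by the maximum principle. This is small at
fixed sites, and at all sites when `N² = o(s)`; otherwise the initial correlations have to be small.
-/

noncomputable section

namespace ReservoirSSEP

/-! ### Semigroups generated by bounded operators -/

section Flow

variable {E : Type*} [NormedAddCommGroup E] [NormedSpace ℝ E]

/-- The semigroup `exp (t A)` generated by a bounded operator `A`. -/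
def flow (A : E →L[ℝ] E) (t : ℝ) : E →L[ℝ] E := NormedSpace.exp (t • A)

@[simp]
lemma flow_zero (A : E →L[ℝ] E) : flow A 0 = 1 := by
  simp [flow]

lemma flow_apply_comm (A : E →L[ℝ] E) (t : ℝ) (f : E) : flow A t (A f) = A (flow A t f) := by
  have h : Commute A (flow A t) := ((Commute.refl A).smul_right t).exp_right
  exact (DFunLike.congr_fun h.eq f).symm

variable [CompleteSpace E]

lemma hasDerivAt_flow (A : E →L[ℝ] E) (t : ℝ) : HasDerivAt (flow A) (flow A t * A) t :=
  hasDerivAt_exp_smul_const A t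

lemma hasDerivAt_flow_apply (A : E →L[ℝ] E) (f : E) (t : ℝ) :
    HasDerivAt (fun s => flow A s f) (A (flow A t f)) t := by
  rw [← flow_apply_comm]
  simpa using (hasDerivAt_flow A t).clm_apply (hasDerivAt_const t f)

lemma hasDerivAt_flow_sub_apply (A : E →L[ℝ] E) {u : ℝ → E} {u' : E} (t r : ℝ)
    (hu : HasDerivAt u u' r) :
    HasDerivAt (fun s => flow A (t - s) (u s)) (flow A (t - r) (u' - A (u r))) r := by
  have h : HasDerivAt (fun s => flow A (t - s)) ((-1 : ℝ) • (flow A (t - r) * A)) r :=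
    (hasDerivAt_flow A (t - r)).scomp r ((hasDerivAt_id r).const_sub t)
  refine (h.clm_apply hu).congr_deriv ?_
  simp [sub_eq_neg_add]

lemma flow_eq_exp_smul_flow_add_smul_one (A : E →L[ℝ] E) (b t : ℝ) :
    flow A t = Real.exp (-(t * b)) • flow (A + b • 1) t := by
  have hshift : t • A = algebraMap ℝ (E →L[ℝ] E) (-(t * b)) + t • (A + b • 1) := by
    rw [Algebra.algebraMap_eq_smul_one, smul_add, smul_smul, neg_smul]
    abel
  let _ : NormedAlgebra ℚ (E →L[ℝ] E) := NormedAlgebra.restrictScalars ℚ ℝ _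
  rw [flow, hshift, NormedSpace.exp_add_of_commute (Algebra.commutes _ _),
    ← NormedSpace.algebraMap_exp_comm, ← Real.exp_eq_exp_ℝ, ← Algebra.smul_def, flow]

lemma flow_mem_of_forall_mem {A : E →L[ℝ] E} {C : PointedCone ℝ E} (hC : IsClosed (C : Set E))
    (hA : ∀ f ∈ C, A f ∈ C) {t : ℝ} (ht : 0 ≤ t) {f : E} (hf : f ∈ C) : flow A t f ∈ C := by
  have hpow : ∀ n : ℕ, (A ^ n) f ∈ C := by
    intro n
    induction n with
    | zero => simpa using hf
    | succ n ih => rw [pow_succ']; exact hA _ ih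
  have hsum : HasSum (fun n : ℕ => ((n.factorial : ℝ)⁻¹ • (t • A) ^ n) f) (flow A t f) :=
    (NormedSpace.exp_series_hasSum_exp' (𝕂 := ℝ) (t • A)).mapL (ContinuousLinearMap.apply ℝ E f)
  refine hC.mem_of_tendsto hsum (Eventually.of_forall fun s => C.sum_mem fun n _ => ?_)
  rw [smul_pow, smul_smul]
  exact C.smul_mem (by positivity) (hpow n)

lemma flow_mem_of_forall_add_smul_mem {A : E →L[ℝ] E} {C : PointedCone ℝ E}
    (hC : IsClosed (C : Set E)) (b : ℝ) (hA : ∀ f ∈ C, A f + b • f ∈ C) {t : ℝ} (ht : 0 ≤ t)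
    {f : E} (hf : f ∈ C) : flow A t f ∈ C := by
  rw [flow_eq_exp_smul_flow_add_smul_one A b]
  exact C.smul_mem (Real.exp_pos _).le
    (flow_mem_of_forall_mem hC (fun g hg => by simpa using hA g hg) ht hf)

lemma flow_mem_submodule {A : E →L[ℝ] E} {S : Submodule ℝ E} (hS : IsClosed (S : Set E))
    (hA : ∀ f ∈ S, A f ∈ S) {t : ℝ} (ht : 0 ≤ t) {f : E} (hf : f ∈ S) : flow A t f ∈ S :=
  flow_mem_of_forall_mem (C := PointedCone.ofSubmodule S) hS hA ht hf

end Flow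

/-! ### Comparison principles -/

section Comparison

variable {ι : Type*}

/-- The positive minimum principle: at the zeros of a nonnegative function, `A f` is nonnegative.
Equivalently, the off-diagonal matrix entries of `A` are nonnegative, as for the generator of a
Markov chain. -/
def IsMetzler (A : (ι → ℝ) →L[ℝ] (ι → ℝ)) : Prop :=
  ∀ f : ι → ℝ, 0 ≤ f → ∀ i, f i = 0 → 0 ≤ A f i

lemma IsMetzler.exists_nonneg_add_smul [Finite ι] {A : (ι → ℝ) →L[ℝ] (ι → ℝ)} (hA : IsMetzler A) :
    ∃ b : ℝ, ∀ f : ι → ℝ, 0 ≤ f → 0 ≤ A f + b • f := by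
  classical
  cases nonempty_fintype ι
  refine ⟨∑ i, |A (Pi.single i 1) i|, fun f hf i => ?_⟩
  set g : ι → ℝ := f - f i • Pi.single i 1 with hg
  have hg_nonneg : 0 ≤ g := by
    intro j
    by_cases hj : j = i
    · subst hj; simp [hg]
    · simpa [hg, hj] using hf j
  have hAf : A f i = f i * A (Pi.single i 1) i + A g i := by
    simp [hg]
  have hdiag : |A (Pi.single i 1) i| ≤ ∑ i, |A (Pi.single i 1) i| :=
    Finset.single_le_sum (f := fun i => |A (Pi.single i 1) i|) (fun _ _ => abs_nonneg _)
      (Finset.mem_univ i)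
  have hAg : 0 ≤ A g i := hA g hg_nonneg i (by simp [hg])
  have hneg := neg_abs_le (A (Pi.single i 1) i)
  simp only [Pi.zero_apply, Pi.add_apply, Pi.smul_apply, smul_eq_mul, hAf]
  nlinarith [mul_nonneg (hf i)
    (by linarith : 0 ≤ A (Pi.single i 1) i + ∑ i, |A (Pi.single i 1) i|)]

/-- The restriction of `A` to the functions supported on `S`: the generator of the walk killed
outside `S`. -/
def restrictTo (S : Set ι) [DecidablePred (· ∈ S)] (A : (ι → ℝ) →L[ℝ] (ι → ℝ)) :
    (ι → ℝ) →L[ℝ] (ι → ℝ) :=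
  let cut : (ι → ℝ) →L[ℝ] (ι → ℝ) :=
    ContinuousLinearMap.pi fun i => if i ∈ S then ContinuousLinearMap.proj i else 0
  cut ∘L A ∘L cut

lemma restrictTo_apply (S : Set ι) [DecidablePred (· ∈ S)] (A : (ι → ℝ) →L[ℝ] (ι → ℝ))
    (f : ι → ℝ) (i : ι) :
    restrictTo S A f i = if i ∈ S then A (fun j => if j ∈ S then f j else 0) i else 0 := by
  have hcut : ∀ g : ι → ℝ, ContinuousLinearMap.pi (fun i => if i ∈ S then
      (ContinuousLinearMap.proj i : (ι → ℝ) →L[ℝ] ℝ) else 0) g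
      = fun i => if i ∈ S then g i else 0 := by
    intro g
    funext j
    by_cases hj : j ∈ S <;> simp [hj]
  simp only [restrictTo, ContinuousLinearMap.comp_apply, hcut]

lemma IsMetzler.restrictTo {A : (ι → ℝ) →L[ℝ] (ι → ℝ)} (hA : IsMetzler A) (S : Set ι)
    [DecidablePred (· ∈ S)] : IsMetzler (restrictTo S A) := by
  intro f hf i hi
  rw [restrictTo_apply]
  split_ifs with hiS
  · refine hA _ (fun j => ?_) i (by simp [hi])
    dsimp only
    split_ifs
    exacts [hf j, le_rfl]
  · exact le_rfl

section Fintype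

variable [Fintype ι]

lemma flow_nonneg {A : (ι → ℝ) →L[ℝ] (ι → ℝ)} (hA : IsMetzler A) {t : ℝ} (ht : 0 ≤ t)
    {f : ι → ℝ} (hf : 0 ≤ f) : 0 ≤ flow A t f := by
  obtain ⟨b, hb⟩ := hA.exists_nonneg_add_smul
  have hclosed : IsClosed (PointedCone.positive ℝ (ι → ℝ) : Set (ι → ℝ)) := isClosed_Ici
  exact flow_mem_of_forall_add_smul_mem hclosed b hb ht hf

lemma flow_mono {A : (ι → ℝ) →L[ℝ] (ι → ℝ)} (hA : IsMetzler A) {t : ℝ} (ht : 0 ≤ t)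
    {f g : ι → ℝ} (hfg : f ≤ g) : flow A t f ≤ flow A t g := by
  have h := flow_nonneg hA ht (sub_nonneg.2 hfg)
  rwa [map_sub, sub_nonneg] at h

lemma monotoneOn_of_hasDerivAt_nonneg {φ φ' : ℝ → ℝ} {a b : ℝ}
    (hφ : ∀ r ∈ Set.Icc a b, HasDerivAt φ (φ' r) r) (h : ∀ r ∈ Set.Icc a b, 0 ≤ φ' r) :
    MonotoneOn φ (Set.Icc a b) :=
  monotoneOn_of_hasDerivWithinAt_nonneg (convex_Icc a b)
    (fun r hr => (hφ r hr).continuousAt.continuousWithinAt)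
    (fun r hr => (hφ r (interior_subset hr)).hasDerivWithinAt)
    (fun r hr => h r (interior_subset hr))

lemma antitoneOn_of_hasDerivAt_nonpos {φ φ' : ℝ → ℝ} {a b : ℝ}
    (hφ : ∀ r ∈ Set.Icc a b, HasDerivAt φ (φ' r) r) (h : ∀ r ∈ Set.Icc a b, φ' r ≤ 0) :
    AntitoneOn φ (Set.Icc a b) :=
  antitoneOn_of_hasDerivWithinAt_nonpos (convex_Icc a b)
    (fun r hr => (hφ r hr).continuousAt.continuousWithinAt)
    (fun r hr => (hφ r (interior_subset hr)).hasDerivWithinAt)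
    (fun r hr => h r (interior_subset hr))

lemma le_flow_of_hasDerivAt_le {A : (ι → ℝ) →L[ℝ] (ι → ℝ)} (hA : IsMetzler A)
    {u u' : ℝ → ι → ℝ} {t : ℝ} (ht : 0 ≤ t) (hu : ∀ r ∈ Set.Icc 0 t, HasDerivAt u (u' r) r)
    (h : ∀ r ∈ Set.Icc 0 t, u' r ≤ A (u r)) : u t ≤ flow A t (u 0) := by
  intro i
  have hanti : AntitoneOn (fun r => flow A (t - r) (u r) i) (Set.Icc 0 t) := by
    refine antitoneOn_of_hasDerivAt_nonpos
      (fun r hr => hasDerivAt_pi.1 (hasDerivAt_flow_sub_apply A t r (hu r hr)) i) fun r hr => ?_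
    have := flow_mono hA (sub_nonneg.2 hr.2) (sub_nonpos.2 (h r hr)) i
    simpa using this
  simpa using hanti ⟨le_rfl, ht⟩ ⟨ht, le_rfl⟩ ht

lemma flow_le_of_le_hasDerivAt {A : (ι → ℝ) →L[ℝ] (ι → ℝ)} (hA : IsMetzler A)
    {u u' : ℝ → ι → ℝ} {t : ℝ} (ht : 0 ≤ t) (hu : ∀ r ∈ Set.Icc 0 t, HasDerivAt u (u' r) r)
    (h : ∀ r ∈ Set.Icc 0 t, A (u r) ≤ u' r) : flow A t (u 0) ≤ u t := by
  have := le_flow_of_hasDerivAt_le hA (u := fun r => -u r) (u' := fun r => -u' r) ht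
    (fun r hr => (hu r hr).neg) (fun r hr => by rw [map_neg]; exact neg_le_neg (h r hr))
  rw [map_neg] at this
  exact neg_le_neg_iff.1 this

lemma eq_flow_of_hasDerivAt {A : (ι → ℝ) →L[ℝ] (ι → ℝ)} (hA : IsMetzler A) {u : ℝ → ι → ℝ}
    {t : ℝ} (ht : 0 ≤ t) (hu : ∀ r ∈ Set.Icc 0 t, HasDerivAt u (A (u r)) r) :
    u t = flow A t (u 0) :=
  le_antisymm (le_flow_of_hasDerivAt_le hA ht hu fun _ _ => le_rfl)
    (flow_le_of_le_hasDerivAt hA ht hu fun _ _ => le_rfl)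

lemma flow_eq_self_of_apply_eq_zero {A : (ι → ℝ) →L[ℝ] (ι → ℝ)} (hA : IsMetzler A) {f : ι → ℝ}
    (hf : A f = 0) {t : ℝ} (ht : 0 ≤ t) : flow A t f = f :=
  (eq_flow_of_hasDerivAt hA (u := fun _ => f) ht fun r _ => hf ▸ hasDerivAt_const r f).symm

end Fintype

lemma parabolic_maximum_principle [Finite ι] {A : (ι → ℝ) →L[ℝ] (ι → ℝ)} (hA : IsMetzler A)
    (S : Set ι) {u u' : ℝ → ι → ℝ} {t : ℝ} (ht : 0 ≤ t)
    (hu : ∀ r ∈ Set.Icc 0 t, HasDerivAt u (u' r) r)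
    (h : ∀ r ∈ Set.Icc 0 t, ∀ i ∈ S, u' r i ≤ A (u r) i)
    (hboundary : ∀ r ∈ Set.Icc 0 t, ∀ i ∉ S, u r i ≤ 0) (hinit : ∀ i ∈ S, u 0 i ≤ 0) :
    u t ≤ 0 := by
  classical
  cases nonempty_fintype ι
  set w : ℝ → ι → ℝ := fun r i => if i ∈ S then u r i else 0 with hw
  have hw_deriv : ∀ r ∈ Set.Icc 0 t, HasDerivAt w (fun i => if i ∈ S then u' r i else 0) r := by
    refine fun r hr => hasDerivAt_pi.2 fun i => ?_
    by_cases hi : i ∈ S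
    · simpa [hw, hi] using hasDerivAt_pi.1 (hu r hr) i
    · simpa [hw, hi] using hasDerivAt_const r (0 : ℝ)
  have hw_le : w t ≤ flow (restrictTo S A) t (w 0) := by
    refine le_flow_of_hasDerivAt_le (hA.restrictTo S) ht hw_deriv fun r hr i => ?_
    rw [restrictTo_apply]
    by_cases hi : i ∈ S
    · have hcut : (fun j => if j ∈ S then w r j else 0) = w r := by
        funext j
        by_cases hj : j ∈ S <;> simp [hw, hj]
      have hdiff : 0 ≤ A (w r - u r) i := by
        refine hA _ (fun j => ?_) i (by simp [hw, hi])
        by_cases hj : j ∈ S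
        · simp [hw, hj]
        · simpa [hw, hj] using hboundary r hr j hj
      rw [map_sub, Pi.sub_apply, sub_nonneg] at hdiff
      simpa only [if_pos hi, hcut] using (h r hr i hi).trans hdiff
    · simp [hi]
  have hw_init : w 0 ≤ 0 := by
    intro i
    by_cases hi : i ∈ S
    · simpa [hw, hi] using hinit i hi
    · simp [hw, hi]
  intro i
  by_cases hi : i ∈ S
  · have := (hw_le.trans (flow_mono (hA.restrictTo S) ht hw_init)) i
    simpa [hw, hi] using this
  · exact hboundary t ⟨ht, le_rfl⟩ i hi

end Comparison

/-! ### Reversible random walks -/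

section Walk

variable {V : Type*} [Fintype V]

/-- The generator of the random walk with jump rates `c x y`. -/
def walkGen (c : V → V → ℝ) : (V → ℝ) →L[ℝ] (V → ℝ) :=
  ContinuousLinearMap.pi fun x =>
    ∑ y, c x y • ((.proj y : (V → ℝ) →L[ℝ] ℝ) - .proj x)

lemma walkGen_apply (c : V → V → ℝ) (f : V → ℝ) (x : V) :
    walkGen c f x = ∑ y, c x y * (f y - f x) := by
  simp [walkGen]

lemma walkGen_const (c : V → V → ℝ) (a : ℝ) : walkGen c (fun _ => a) = 0 := by
  funext x
  simp [walkGen_apply]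

lemma walkGen_mul_const (c : V → V → ℝ) (f : V → ℝ) (a : ℝ) (x : V) :
    walkGen c (fun y => f y * a) x = walkGen c f x * a := by
  simp only [walkGen_apply, Finset.sum_mul, ← sub_mul, mul_assoc]

lemma walkGen_const_mul (c : V → V → ℝ) (a : ℝ) (f : V → ℝ) (x : V) :
    walkGen c (fun y => a * f y) x = a * walkGen c f x := by
  simp only [mul_comm a, walkGen_mul_const]

lemma walkGen_rate_add (c d : V → V → ℝ) (f : V → ℝ) (x : V) :
    walkGen (c + d) f x = walkGen c f x + walkGen d f x := by
  simp only [walkGen_apply, Pi.add_apply, add_mul, Finset.sum_add_distrib]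

lemma isMetzler_walkGen {c : V → V → ℝ} (hc : ∀ x y, 0 ≤ c x y) : IsMetzler (walkGen c) := by
  intro f hf x hx
  rw [walkGen_apply, hx]
  exact Finset.sum_nonneg fun y _ => mul_nonneg (hc x y) (by simpa using hf y)

/-- The Dirichlet form `∑ x, ∑ y, c x y (f x - f y) (g x - g y)`, without the customary factor
`1 / 2`. -/
def dirichlet (c : V → V → ℝ) (f g : V → ℝ) : ℝ :=
  ∑ x, ∑ y, c x y * ((f x - f y) * (g x - g y))

lemma dirichlet_comm (c : V → V → ℝ) (f g : V → ℝ) : dirichlet c f g = dirichlet c g f := by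
  simp only [dirichlet, mul_comm (f _ - f _)]

lemma dirichlet_self_nonneg {c : V → V → ℝ} (hc : ∀ x y, 0 ≤ c x y) (f : V → ℝ) :
    0 ≤ dirichlet c f f :=
  Finset.sum_nonneg fun x _ => Finset.sum_nonneg fun y _ =>
    mul_nonneg (hc x y) (mul_self_nonneg _)

lemma dirichlet_eq_neg_two_mul_sum {c : V → V → ℝ} (hs : ∀ x y, c x y = c y x) (f g : V → ℝ) :
    dirichlet c f g = -2 * ∑ x, g x * walkGen c f x := by
  have hswap : ∑ x, ∑ y, c x y * (f x - f y) * g y = -∑ x, ∑ y, c x y * (f x - f y) * g x := by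
    rw [Finset.sum_comm]
    simp only [← Finset.sum_neg_distrib]
    exact Finset.sum_congr rfl fun x _ => Finset.sum_congr rfl fun y _ => by rw [hs y x]; ring
  have hgen : ∑ x, g x * walkGen c f x = -∑ x, ∑ y, c x y * (f x - f y) * g x := by
    simp only [walkGen_apply, Finset.mul_sum, ← Finset.sum_neg_distrib]
    exact Finset.sum_congr rfl fun x _ => Finset.sum_congr rfl fun y _ => by ring
  calc dirichlet c f g
      = ∑ x, ∑ y, c x y * (f x - f y) * g x - ∑ x, ∑ y, c x y * (f x - f y) * g y := by
        simp only [dirichlet, ← Finset.sum_sub_distrib]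
        exact Finset.sum_congr rfl fun x _ => Finset.sum_congr rfl fun y _ => by ring
    _ = -2 * ∑ x, g x * walkGen c f x := by rw [hswap, hgen]; ring

lemma sum_walkGen_mul {c : V → V → ℝ} (hs : ∀ x y, c x y = c y x) (f g : V → ℝ) :
    ∑ x, walkGen c g x * f x = ∑ x, g x * walkGen c f x := by
  have hfg := dirichlet_eq_neg_two_mul_sum hs f g
  have hgf := dirichlet_eq_neg_two_mul_sum hs g f
  rw [dirichlet_comm] at hgf
  simp only [mul_comm (walkGen c g _)]
  linarith

lemma sum_flow_sub_mul_flow {c : V → V → ℝ} (hs : ∀ x y, c x y = c y x) (f g : V → ℝ)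
    (t r : ℝ) : ∑ x, flow (walkGen c) (t - r) g x * flow (walkGen c) r f x
      = ∑ x, flow (walkGen c) t g x * f x := by
  set φ : ℝ → ℝ := fun r => ∑ x, flow (walkGen c) (t - r) g x * flow (walkGen c) r f x with hφ
  have hφ_deriv : ∀ r, HasDerivAt φ 0 r := by
    intro r
    have hsum : HasDerivAt φ (∑ x, (flow (walkGen c) (t - r) (0 - walkGen c g) x
        * flow (walkGen c) r f x
        + flow (walkGen c) (t - r) g x * walkGen c (flow (walkGen c) r f) x)) r :=
      HasDerivAt.fun_sum fun x _ =>
        (hasDerivAt_pi.1 (hasDerivAt_flow_sub_apply _ t r (hasDerivAt_const r g)) x).mul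
          (hasDerivAt_pi.1 (hasDerivAt_flow_apply (walkGen c) f r) x)
    refine hsum.congr_deriv ?_
    rw [Finset.sum_add_distrib, ← sum_walkGen_mul hs]
    simp [flow_apply_comm]
  have hconst := is_const_of_deriv_eq_zero (fun r => (hφ_deriv r).differentiableAt)
    (fun r => (hφ_deriv r).deriv) r 0
  simpa [hφ] using hconst

lemma sum_flow_walkGen_mul {c : V → V → ℝ} (hs : ∀ x y, c x y = c y x) (f g : V → ℝ) (t : ℝ) :
    ∑ x, flow (walkGen c) t g x * f x = ∑ x, g x * flow (walkGen c) t f x := by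
  simpa using (sum_flow_sub_mul_flow hs f g t t).symm

lemma flow_walkGen_const {c : V → V → ℝ} (hc : ∀ x y, 0 ≤ c x y) (a : ℝ) {t : ℝ} (ht : 0 ≤ t) :
    flow (walkGen c) t (fun _ => a) = fun _ => a :=
  flow_eq_self_of_apply_eq_zero (isMetzler_walkGen hc) (walkGen_const c a) ht

lemma flow_walkGen_mem_Icc {c : V → V → ℝ} (hc : ∀ x y, 0 ≤ c x y) {f : V → ℝ} {a b : ℝ}
    (hf : ∀ x, f x ∈ Set.Icc a b) {t : ℝ} (ht : 0 ≤ t) (x : V) :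
    flow (walkGen c) t f x ∈ Set.Icc a b := by
  have hlower := flow_mono (isMetzler_walkGen hc) ht (show (fun _ => a) ≤ f from
    fun x => (hf x).1) x
  have hupper := flow_mono (isMetzler_walkGen hc) ht (show f ≤ fun _ => b from
    fun x => (hf x).2) x
  rw [flow_walkGen_const hc _ ht] at hlower hupper
  exact ⟨hlower, hupper⟩

lemma sum_flow_walkGen {c : V → V → ℝ} (hc : ∀ x y, 0 ≤ c x y) (hs : ∀ x y, c x y = c y x)
    (f : V → ℝ) {t : ℝ} (ht : 0 ≤ t) : ∑ x, flow (walkGen c) t f x = ∑ x, f x := by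
  simpa [flow_walkGen_const hc 1 ht] using sum_flow_walkGen_mul hs (fun _ => 1) f t

section Single

variable [DecidableEq V] {c : V → V → ℝ}

lemma flow_walkGen_single_mem_Icc (hc : ∀ x y, 0 ≤ c x y) {t : ℝ} (ht : 0 ≤ t) (x y : V) :
    flow (walkGen c) t (Pi.single x 1) y ∈ Set.Icc (0 : ℝ) 1 := by
  refine flow_walkGen_mem_Icc hc (fun z => ?_) ht y
  rw [Pi.single_apply]
  split_ifs <;> simp

lemma sum_flow_walkGen_single (hc : ∀ x y, 0 ≤ c x y) (hs : ∀ x y, c x y = c y x) {t : ℝ}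
    (ht : 0 ≤ t) (x : V) : ∑ y, flow (walkGen c) t (Pi.single x 1) y = 1 := by
  rw [sum_flow_walkGen hc hs _ ht]
  simp

lemma flow_walkGen_single_comm (hs : ∀ x y, c x y = c y x) (t : ℝ) (x y : V) :
    flow (walkGen c) t (Pi.single x 1) y = flow (walkGen c) t (Pi.single y 1) x := by
  simpa [Pi.single_apply] using (sum_flow_walkGen_mul hs (Pi.single x 1) (Pi.single y 1) t).symm

lemma flow_walkGen_single_le_sum_sq (hs : ∀ x y, c x y = c y x) (t : ℝ) (x y : V) :
    flow (walkGen c) t (Pi.single x 1) y ≤ ((∑ z, flow (walkGen c) (t / 2) (Pi.single x 1) z ^ 2)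
      + ∑ z, flow (walkGen c) (t / 2) (Pi.single y 1) z ^ 2) / 2 := by
  set p := fun a z => flow (walkGen c) (t / 2) (Pi.single a 1) z
  have hsplit : ∑ z, p x z * p y z = flow (walkGen c) t (Pi.single x 1) y := by
    have h := sum_flow_sub_mul_flow hs (Pi.single y 1) (Pi.single x 1) t (t / 2)
    rw [sub_half] at h
    simpa [Pi.single_apply] using h
  calc flow (walkGen c) t (Pi.single x 1) y
      = ∑ z, p x z * p y z := hsplit.symm
    _ ≤ ∑ z, (p x z ^ 2 + p y z ^ 2) / 2 :=
        Finset.sum_le_sum fun z _ => by linarith [two_mul_le_add_sq (p x z) (p y z)]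
    _ = _ := by rw [← Finset.sum_div, Finset.sum_add_distrib]

end Single

lemma hasDerivAt_sum_sq_sub {c : V → V → ℝ} (hs : ∀ x y, c x y = c y x) {u : ℝ → V → ℝ} {r : ℝ}
    (hu : HasDerivAt u (walkGen c (u r)) r) (l : V → ℝ) :
    HasDerivAt (fun r => ∑ x, (u r x - l x) ^ 2)
      (-dirichlet c (u r) (fun x => u r x - l x)) r := by
  have hsum : HasDerivAt (fun r => ∑ x, (u r x - l x) ^ 2)
      (∑ x, ((2 : ℕ) : ℝ) * (u r x - l x) ^ (2 - 1) * walkGen c (u r) x) r :=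
    HasDerivAt.fun_sum fun x _ => ((hasDerivAt_pi.1 hu x).sub_const (l x)).pow 2
  refine hsum.congr_deriv ?_
  rw [dirichlet_eq_neg_two_mul_sum hs, Finset.mul_sum, ← Finset.sum_neg_distrib]
  exact Finset.sum_congr rfl fun x _ => by push_cast; ring

lemma hasDerivAt_dirichlet_self {c : V → V → ℝ} (hs : ∀ x y, c x y = c y x) {u : ℝ → V → ℝ}
    {r : ℝ} (hu : HasDerivAt u (walkGen c (u r)) r) :
    HasDerivAt (fun r => dirichlet c (u r) (u r)) (-4 * ∑ x, walkGen c (u r) x ^ 2) r := by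
  have hsum : HasDerivAt (fun r => dirichlet c (u r) (u r))
      (∑ x, ∑ y, c x y * ((walkGen c (u r) x - walkGen c (u r) y) * (u r x - u r y)
        + (u r x - u r y) * (walkGen c (u r) x - walkGen c (u r) y))) r := by
    refine HasDerivAt.fun_sum fun x _ => HasDerivAt.fun_sum fun y _ => ?_
    have hxy := (hasDerivAt_pi.1 hu x).sub (hasDerivAt_pi.1 hu y)
    exact (hxy.mul hxy).const_mul (c x y)
  refine hsum.congr_deriv ?_
  calc _ = 2 * dirichlet c (u r) (walkGen c (u r)) := by
        simp only [dirichlet, Finset.mul_sum]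
        exact Finset.sum_congr rfl fun x _ => Finset.sum_congr rfl fun y _ => by ring
    _ = -4 * ∑ x, walkGen c (u r) x ^ 2 := by
        rw [dirichlet_eq_neg_two_mul_sum hs]
        simp only [← pow_two]
        ring

lemma antitoneOn_dirichlet_self {c : V → V → ℝ} (hs : ∀ x y, c x y = c y x) {u : ℝ → V → ℝ}
    {a b : ℝ} (hu : ∀ r ∈ Set.Icc a b, HasDerivAt u (walkGen c (u r)) r) :
    AntitoneOn (fun r => dirichlet c (u r) (u r)) (Set.Icc a b) :=
  antitoneOn_of_hasDerivAt_nonpos (fun r hr => hasDerivAt_dirichlet_self hs (hu r hr))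
    fun r _ => mul_nonpos_of_nonpos_of_nonneg (by norm_num)
      (Finset.sum_nonneg fun _ _ => sq_nonneg _)

end Walk

/-! ### Two walkers with exclusion -/

section ExclusionPair

variable {V : Type*} [DecidableEq V]

/-- The function on pairs which is `F` off the diagonal and `0` on the diagonal; the diagonal is
out of reach of two walkers with exclusion. -/
def offDiag (F : V → V → ℝ) (p : V × V) : ℝ := if p.1 = p.2 then 0 else F p.1 p.2

lemma offDiag_of_ne (F : V → V → ℝ) {x y : V} (h : x ≠ y) : offDiag F (x, y) = F x y := if_neg h

lemma offDiag_self (F : V → V → ℝ) (x : V) : offDiag F (x, x) = 0 := if_pos rfl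

lemma offDiag_mono {F G : V → V → ℝ} (h : ∀ x y, x ≠ y → F x y ≤ G x y) :
    offDiag F ≤ offDiag G := by
  intro p
  unfold offDiag
  split_ifs with hp
  · exact le_rfl
  · exact h _ _ hp

lemma offDiag_nonneg {F : V → V → ℝ} (h : ∀ x y, 0 ≤ F x y) : 0 ≤ offDiag F := by
  intro p
  unfold offDiag
  split_ifs
  · exact le_rfl
  · exact h _ _

lemma hasDerivAt_offDiag {F : ℝ → V → V → ℝ} {F' : V → V → ℝ} {r : ℝ}
    (h : ∀ x y, x ≠ y → HasDerivAt (fun r => F r x y) (F' x y) r) :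
    HasDerivAt (fun r => offDiag (F r)) (offDiag F') r := by
  rw [hasDerivAt_pi]
  rintro ⟨x, y⟩
  by_cases hxy : x = y
  · subst hxy
    simpa only [offDiag_self] using hasDerivAt_const r (0 : ℝ)
  · simpa only [offDiag_of_ne _ hxy] using h x y hxy

variable [Fintype V]

/-- The generator of two walkers with jump rates `c x y` and exclusion: a jump of one walker to the
position of the other one is suppressed. The points of the diagonal are absorbing. -/
def pairGen (c : V → V → ℝ) : (V × V → ℝ) →L[ℝ] (V × V → ℝ) :=
  ContinuousLinearMap.pi fun p => if p.1 = p.2 then 0 else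
    ∑ z, (if z = p.2 then 0 else
        c p.1 z • ((.proj (z, p.2) : (V × V → ℝ) →L[ℝ] ℝ) - .proj p))
      + ∑ z, (if z = p.1 then 0 else
        c p.2 z • ((.proj (p.1, z) : (V × V → ℝ) →L[ℝ] ℝ) - .proj p))

lemma pairGen_apply_of_ne (c : V → V → ℝ) (F : V × V → ℝ) {x y : V} (h : x ≠ y) :
    pairGen c F (x, y) = ∑ z, (if z = y then 0 else c x z * (F (z, y) - F (x, y)))
      + ∑ z, (if z = x then 0 else c y z * (F (x, z) - F (x, y))) := by
  simp only [pairGen, ContinuousLinearMap.coe_pi', if_neg h, add_apply, sum_apply,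
    apply_ite (fun T : (V × V → ℝ) →L[ℝ] ℝ => T F), zero_apply, smul_apply, sub_apply,
    ContinuousLinearMap.proj_apply, smul_eq_mul]

lemma pairGen_apply_self (c : V → V → ℝ) (F : V × V → ℝ) (x : V) :
    pairGen c F (x, x) = 0 := by
  simp [pairGen]

lemma isMetzler_pairGen {c : V → V → ℝ} (hc : ∀ x y, 0 ≤ c x y) : IsMetzler (pairGen c) := by
  rintro F hF ⟨x, y⟩ hxy
  by_cases h : x = y
  · subst h
    rw [pairGen_apply_self]
  · rw [pairGen_apply_of_ne c _ h, hxy]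
    refine add_nonneg (Finset.sum_nonneg fun z _ => ?_) (Finset.sum_nonneg fun z _ => ?_)
    · split_ifs
      · exact le_rfl
      · simpa using mul_nonneg (hc x z) (hF (z, y))
    · split_ifs
      · exact le_rfl
      · simpa using mul_nonneg (hc y z) (hF (x, z))

lemma sum_ite_eq_zero_else {R : Type*} [AddCommGroup R] (g : V → R) (a : V) :
    ∑ z, (if z = a then 0 else g z) = ∑ z, g z - g a := by
  rw [← Finset.sum_erase_eq_sub (Finset.mem_univ a), ← Finset.filter_ne', Finset.sum_filter]
  exact Finset.sum_congr rfl fun z _ => by simp only [ne_eq, ite_not]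

lemma pairGen_offDiag_of_ne (c : V → V → ℝ) (F : V → V → ℝ) {x y : V} (h : x ≠ y) :
    pairGen c (offDiag F) (x, y) =
      walkGen c (fun z => F z y) x - c x y * (F y y - F x y)
        + (walkGen c (fun z => F x z) y - c y x * (F x x - F x y)) := by
  rw [pairGen_apply_of_ne c _ h, walkGen_apply, walkGen_apply,
    ← sum_ite_eq_zero_else (fun z => c x z * (F z y - F x y)),
    ← sum_ite_eq_zero_else (fun z => c y z * (F x z - F x y)), offDiag_of_ne _ h]
  congr 1 <;> refine Finset.sum_congr rfl fun z _ => ?_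
  · split_ifs with hz
    · rfl
    · rw [offDiag_of_ne _ hz]
  · split_ifs with hz
    · rfl
    · rw [offDiag_of_ne _ (Ne.symm hz)]

lemma pairGen_offDiag_mul {c : V → V → ℝ} (hs : ∀ x y, c x y = c y x) (v : V → ℝ) :
    pairGen c (offDiag fun a b => v a * v b) = offDiag fun a b =>
      walkGen c v a * v b + v a * walkGen c v b - c a b * (v a - v b) ^ 2 := by
  funext ⟨x, y⟩
  by_cases h : x = y
  · subst h
    rw [pairGen_apply_self, offDiag_self]
  · rw [pairGen_offDiag_of_ne c _ h, offDiag_of_ne _ h, walkGen_mul_const, walkGen_const_mul,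
      hs y x]
    ring

lemma pairGen_offDiag_add {c : V → V → ℝ} (hs : ∀ x y, c x y = c y x) (v : V → ℝ) :
    pairGen c (offDiag fun a b => v a + v b) = offDiag fun a b =>
      walkGen c v a + walkGen c v b := by
  funext ⟨x, y⟩
  by_cases h : x = y
  · subst h
    rw [pairGen_apply_self, offDiag_self]
  · simp only [pairGen_offDiag_of_ne c _ h, offDiag_of_ne _ h, walkGen_apply, hs y x,
      add_sub_add_right_eq_sub, add_sub_add_left_eq_sub]
    ring

lemma pairGen_offDiag_const (c : V → V → ℝ) (a : ℝ) : pairGen c (offDiag fun _ _ => a) = 0 := by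
  funext ⟨x, y⟩
  by_cases h : x = y
  · subst h
    rw [pairGen_apply_self, Pi.zero_apply]
  · simp [pairGen_offDiag_of_ne c _ h, walkGen_apply]

/-- Liggett's comparison: two walkers with exclusion are negatively dependent. -/
lemma flow_pairGen_mul_le {c : V → V → ℝ} (hc : ∀ x y, 0 ≤ c x y) (hs : ∀ x y, c x y = c y x)
    (v : V → ℝ) {t : ℝ} (ht : 0 ≤ t) {x y : V} (hxy : x ≠ y) :
    flow (pairGen c) t (offDiag fun a b => v a * v b) (x, y)
      ≤ flow (walkGen c) t v x * flow (walkGen c) t v y := by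
  have hv : ∀ r a, HasDerivAt (fun r => flow (walkGen c) r v a)
      (walkGen c (flow (walkGen c) r v) a) r :=
    fun r => hasDerivAt_pi.1 (hasDerivAt_flow_apply (walkGen c) v r)
  have hle := flow_le_of_le_hasDerivAt (isMetzler_pairGen hc)
    (u := fun r => offDiag fun a b => flow (walkGen c) r v a * flow (walkGen c) r v b) ht
    (fun r _ => hasDerivAt_offDiag fun a b _ => (hv r a).mul (hv r b))
    (fun r _ => by
      rw [pairGen_offDiag_mul hs]
      exact offDiag_mono fun a b _ => sub_le_self _ (mul_nonneg (hc a b) (sq_nonneg _)))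
  simpa [offDiag_of_ne _ hxy] using hle (x, y)

lemma flow_pairGen_add {c : V → V → ℝ} (hc : ∀ x y, 0 ≤ c x y) (hs : ∀ x y, c x y = c y x)
    (v : V → ℝ) {t : ℝ} (ht : 0 ≤ t) :
    flow (pairGen c) t (offDiag fun a b => v a + v b)
      = offDiag fun a b => flow (walkGen c) t v a + flow (walkGen c) t v b := by
  have hv : ∀ r a, HasDerivAt (fun r => flow (walkGen c) r v a)
      (walkGen c (flow (walkGen c) r v) a) r :=
    fun r => hasDerivAt_pi.1 (hasDerivAt_flow_apply (walkGen c) v r)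
  have heq := eq_flow_of_hasDerivAt (isMetzler_pairGen hc)
    (u := fun r => offDiag fun a b => flow (walkGen c) r v a + flow (walkGen c) r v b) ht
    (fun r _ => by
      rw [pairGen_offDiag_add hs]
      exact hasDerivAt_offDiag fun a b _ => (hv r a).add (hv r b))
  simpa using heq.symm

lemma flow_pairGen_const {c : V → V → ℝ} (hc : ∀ x y, 0 ≤ c x y) (a : ℝ) {t : ℝ} (ht : 0 ≤ t) :
    flow (pairGen c) t (offDiag fun _ _ => a) = offDiag fun _ _ => a :=
  flow_eq_self_of_apply_eq_zero (isMetzler_pairGen hc) (pairGen_offDiag_const c a) ht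

/-- The indicator function of the endpoints of the edge `{a, b}`. -/
def edgeIndicator (a b : V) : V → ℝ := Pi.single a 1 + Pi.single b 1

omit [Fintype V] in
lemma edgeIndicator_nonneg (a b : V) : 0 ≤ edgeIndicator a b :=
  add_nonneg (Pi.single_nonneg.2 zero_le_one) (Pi.single_nonneg.2 zero_le_one)

lemma offDiag_le_sum_edgeIndicator {w : V → V → ℝ} (hw : ∀ a b, 0 ≤ w a b) :
    offDiag w ≤ ∑ a, ∑ b,
      w a b • offDiag fun x y => edgeIndicator a b x * edgeIndicator a b y := by
  have hterm : ∀ a b, 0 ≤ w a b • offDiag fun x y => edgeIndicator a b x * edgeIndicator a b y :=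
    fun a b => smul_nonneg (hw a b) (offDiag_nonneg fun x y =>
      mul_nonneg (edgeIndicator_nonneg a b x) (edgeIndicator_nonneg a b y))
  have hsum : ∀ a, 0 ≤ ∑ b, w a b • offDiag fun x y => edgeIndicator a b x * edgeIndicator a b y :=
    fun a => Finset.sum_nonneg fun b _ => hterm a b
  rintro ⟨x, y⟩
  by_cases hxy : x = y
  · subst hxy
    rw [offDiag_self]
    exact Finset.sum_nonneg (fun a _ => hsum a) (x, x)
  · calc offDiag w (x, y)
        = (w x y • offDiag fun a b => edgeIndicator x y a * edgeIndicator x y b) (x, y) := by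
          simp [offDiag_of_ne _ hxy, edgeIndicator, hxy, Ne.symm hxy]
      _ ≤ _ := Finset.single_le_sum (fun b _ => hterm x b) (Finset.mem_univ y) (x, y)
      _ ≤ _ := Finset.single_le_sum (fun a _ => hsum a) (Finset.mem_univ x) (x, y)

/-- By negative dependence, both walkers sit at the ends of a given edge with probability at most
the product of two single-walker probabilities. -/
lemma flow_pairGen_source_le {c : V → V → ℝ} (hc : ∀ x y, 0 ≤ c x y) (hs : ∀ x y, c x y = c y x)
    (u : V → ℝ) {t q : ℝ} (ht : 0 ≤ t) {x y : V} (hxy : x ≠ y)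
    (hx : ∀ a, flow (walkGen c) t (Pi.single a 1) x ≤ q)
    (hy : ∀ a, flow (walkGen c) t (Pi.single a 1) y ≤ q) :
    flow (pairGen c) t (offDiag fun a b => c a b * (u a - u b) ^ 2) (x, y)
      ≤ 4 * q ^ 2 * dirichlet c u u := by
  have hw : ∀ a b, 0 ≤ c a b * (u a - u b) ^ 2 := fun a b => mul_nonneg (hc a b) (sq_nonneg _)
  have hflow : ∀ a b, 0 ≤ flow (walkGen c) t (edgeIndicator a b) :=
    fun a b => flow_nonneg (isMetzler_walkGen hc) ht (edgeIndicator_nonneg a b)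
  have hendpoints : ∀ {z}, (∀ a, flow (walkGen c) t (Pi.single a 1) z ≤ q) → ∀ a b,
      flow (walkGen c) t (edgeIndicator a b) z ≤ 2 * q := fun hz a b => by
    rw [edgeIndicator, map_add, Pi.add_apply, two_mul]
    exact add_le_add (hz a) (hz b)
  have hedge : ∀ a b, flow (pairGen c) t
      (offDiag fun e f => edgeIndicator a b e * edgeIndicator a b f) (x, y) ≤ 4 * q ^ 2 :=
    fun a b => calc
      _ ≤ flow (walkGen c) t (edgeIndicator a b) x * flow (walkGen c) t (edgeIndicator a b) y :=
        flow_pairGen_mul_le hc hs _ ht hxy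
      _ ≤ (2 * q) * (2 * q) :=
        mul_le_mul (hendpoints hx a b) (hendpoints hy a b) (hflow a b y)
          ((hflow a b x).trans (hendpoints hx a b))
      _ = 4 * q ^ 2 := by ring
  refine (flow_mono (isMetzler_pairGen hc) ht (offDiag_le_sum_edgeIndicator hw) (x, y)).trans ?_
  simp only [map_sum, map_smul, Finset.sum_apply, Pi.smul_apply, smul_eq_mul, dirichlet,
    Finset.mul_sum]
  refine Finset.sum_le_sum fun a _ => Finset.sum_le_sum fun b _ => ?_
  calc _ ≤ c a b * (u a - u b) ^ 2 * (4 * q ^ 2) := mul_le_mul_of_nonneg_left (hedge a b) (hw a b)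
    _ = _ := by ring

end ExclusionPair

/-! ### The channel with its reservoirs as a weighted graph -/

section Graph

/-- The two ends of the channel, and the two reservoirs attached there. -/
inductive Side
  | left
  | right
  deriving DecidableEq

instance : Fintype Side := ⟨{.left, .right}, fun σ => by cases σ <;> simp⟩

lemma sum_side {R : Type*} [AddCommMonoid R] (f : Side → R) : ∑ σ, f σ = f .left + f .right :=
  Finset.sum_pair (by simp)

/-- The sites of the channel together with `M` further sites for each of the two reservoirs. -/
abbrev Vertex (N M : ℕ) : Type := Site N ⊕ (Side × Fin M)

/-- The position of the left (right) reservoir is `0` (`N + 1`). -/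
def Side.pos (N : ℕ) : Side → ℕ
  | left => 0
  | right => N + 1

/-- The position of a vertex. All the vertices of a reservoir share one position. -/
def pos {N M : ℕ} : Vertex N M → ℕ
  | .inl x => x
  | .inr z => z.1.pos N

/-- The weight of a vertex at position `k`: the rate of an edge is half the product of the weights
of its endpoints. -/
def weight (N M k : ℕ) : ℝ := if k = 0 ∨ k = N + 1 then 1 / (M : ℝ) else 1

/-- The stirring rates: `1 / 2` between neighbouring sites and `1 / (2 * M)` between a vertex of a
reservoir and the adjacent site of the channel. -/
def rate (N M : ℕ) (v w : Vertex N M) : ℝ :=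
  if pos w = pos v + 1 ∨ pos v = pos w + 1 then weight N M (pos v) * weight N M (pos w) / 2 else 0

variable {N M : ℕ}

lemma weight_nonneg (k : ℕ) : 0 ≤ weight N M k := by
  unfold weight
  split_ifs <;> positivity

lemma weight_le_one (hM : 0 < M) (k : ℕ) : weight N M k ≤ 1 := by
  unfold weight
  split_ifs
  · rw [div_le_one (by positivity)]
    exact_mod_cast hM
  · exact le_rfl

lemma weight_of_mem {k : ℕ} (hk : k ∈ Finset.Icc 1 N) : weight N M k = 1 := by
  rw [Finset.mem_Icc] at hk
  exact if_neg (by omega)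

lemma weight_side_pos (σ : Side) : weight N M (σ.pos N) = 1 / M := by
  cases σ <;> simp [weight, Side.pos]

lemma rate_nonneg (v w : Vertex N M) : 0 ≤ rate N M v w := by
  unfold rate
  split_ifs
  · exact div_nonneg (mul_nonneg (weight_nonneg _) (weight_nonneg _)) zero_le_two
  · exact le_rfl

lemma rate_symm (v w : Vertex N M) : rate N M v w = rate N M w v := by
  unfold rate
  rw [mul_comm (weight N M (pos v))]
  exact if_congr or_comm rfl rfl

lemma pos_le (v : Vertex N M) : pos v ≤ N + 1 := by
  rcases v with ⟨x, hx⟩ | ⟨_ | _, i⟩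
  · exact (Finset.mem_Icc.1 hx).2.trans N.le_succ
  · exact Nat.zero_le _
  · exact le_rfl

lemma sum_site (F : ℕ → ℝ) : ∑ x : Site N, F x = ∑ k ∈ Finset.range N, F (k + 1) := by
  rw [Finset.sum_coe_sort (Finset.Icc 1 N) F, Finset.range_eq_Ico, Finset.sum_Ico_add' F 0 N 1]
  rfl

lemma sum_weight_mul (hM : 0 < M) (F : ℕ → ℝ) :
    ∑ v : Vertex N M, weight N M (pos v) * F (pos v) = ∑ k ∈ Finset.range (N + 2), F k := by
  have hM' : (M : ℝ) ≠ 0 := by positivity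
  have hsites : ∑ x : Site N, weight N M x * F x = ∑ k ∈ Finset.range N, F (k + 1) := by
    rw [← sum_site]
    exact Finset.sum_congr rfl fun x _ => by rw [weight_of_mem x.2, one_mul]
  have hside : ∀ σ : Side, ∑ _i : Fin M, weight N M (σ.pos N) * F (σ.pos N) = F (σ.pos N) := by
    intro σ
    rw [weight_side_pos, Finset.sum_const, Finset.card_univ, Fintype.card_fin, nsmul_eq_mul]
    field_simp
  rw [Fintype.sum_sum_type, Fintype.sum_prod_type, sum_side, Finset.sum_range_succ,
    Finset.sum_range_succ']
  simp only [pos, hsites, hside]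
  simp only [Side.pos]
  ring

/-- The functions on the vertices that depend only on the position. -/
def lumped (N M : ℕ) : Submodule ℝ (Vertex N M → ℝ) :=
  LinearMap.range (LinearMap.funLeft ℝ ℝ (pos (N := N) (M := M)))

lemma mem_lumped {f : Vertex N M → ℝ} : f ∈ lumped N M ↔ ∃ F : ℕ → ℝ, f = fun v => F (pos v) :=
  exists_congr fun _ => eq_comm

lemma mem_lumped_of_forall {f : Vertex N M → ℝ} (h : ∀ v w, pos v = pos w → f v = f w) :
    f ∈ lumped N M :=
  mem_lumped.2 ((Function.factorsThrough_iff f).1 fun v w => h v w)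

lemma eq_of_mem_lumped {f : Vertex N M → ℝ} (hf : f ∈ lumped N M) {v w : Vertex N M}
    (h : pos v = pos w) : f v = f w := by
  obtain ⟨F, rfl⟩ := mem_lumped.1 hf
  exact congrArg F h

lemma walkGen_rate_lumped (hM : 0 < M) (F : ℕ → ℝ) (v : Vertex N M) :
    walkGen (rate N M) (fun v => F (pos v)) v = weight N M (pos v) / 2 *
      ∑ k ∈ Finset.range (N + 2),
        if k = pos v + 1 ∨ pos v = k + 1 then F k - F (pos v) else 0 := by
  rw [walkGen_apply, ← sum_weight_mul hM, Finset.mul_sum]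
  refine Finset.sum_congr rfl fun w _ => ?_
  unfold rate
  split_ifs <;> ring

lemma walkGen_mem_lumped (hM : 0 < M) {f : Vertex N M → ℝ} (hf : f ∈ lumped N M) :
    walkGen (rate N M) f ∈ lumped N M := by
  obtain ⟨F, rfl⟩ := mem_lumped.1 hf
  refine mem_lumped_of_forall fun v w h => ?_
  rw [walkGen_rate_lumped hM, walkGen_rate_lumped hM, h]

lemma flow_mem_lumped (hM : 0 < M) {f : Vertex N M → ℝ} (hf : f ∈ lumped N M) {t : ℝ}
    (ht : 0 ≤ t) : flow (walkGen (rate N M)) t f ∈ lumped N M :=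
  flow_mem_submodule (lumped N M).closed_of_finiteDimensional
    (fun _ hf => walkGen_mem_lumped hM hf) ht hf

lemma ite_neighbour_eq_add (j k : ℕ) (a : ℝ) :
    (if k = j + 1 ∨ j = k + 1 then a else 0)
      = (if k = j + 1 then a else 0) + (if j = k + 1 then a else 0) := by
  split_ifs <;> first | omega | simp

lemma sum_neighbours (F : ℕ → ℝ) {p : ℕ} (hp : p ∈ Finset.Icc 1 N) :
    (∑ k ∈ Finset.range (N + 2), if k = p + 1 ∨ p = k + 1 then F k else 0)
      = F (p + 1) + F (p - 1) := by
  rw [Finset.mem_Icc] at hp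
  have hpred : ∀ k, p = k + 1 ↔ k = p - 1 := fun k => by omega
  simp only [ite_neighbour_eq_add]
  simp only [hpred, Finset.sum_add_distrib, Finset.sum_ite_eq', Finset.mem_range]
  rw [if_pos (by omega), if_pos (by omega)]

lemma walkGen_rate_site (hM : 0 < M) (F : ℕ → ℝ) (x : Site N) :
    walkGen (rate N M) (fun v => F (pos v)) (.inl x) =
      (F (x + 1) + F (x - 1) - 2 * F x) / 2 := by
  rw [walkGen_rate_lumped hM, show pos (.inl x : Vertex N M) = x from rfl,
    sum_neighbours (fun k => F k - F x) x.2, weight_of_mem x.2]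
  ring

lemma dirichlet_rate_lumped (hM : 0 < M) (F : ℕ → ℝ) :
    dirichlet (rate N M) (fun v => F (pos v)) (fun v => F (pos v)) =
      ∑ k ∈ Finset.range (N + 1), (F (k + 1) - F k) ^ 2 := by
  have hpositions : dirichlet (rate N M) (fun v => F (pos v)) (fun v => F (pos v)) =
      ∑ j ∈ Finset.range (N + 2), ∑ k ∈ Finset.range (N + 2),
        if k = j + 1 ∨ j = k + 1 then (F j - F k) ^ 2 / 2 else 0 := by
    rw [dirichlet, ← sum_weight_mul hM]
    refine Finset.sum_congr rfl fun v _ => ?_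
    rw [← sum_weight_mul hM, Finset.mul_sum]
    refine Finset.sum_congr rfl fun w _ => ?_
    unfold rate
    split_ifs <;> ring
  have hup : ∑ j ∈ Finset.range (N + 2), ∑ k ∈ Finset.range (N + 2),
      (if k = j + 1 then (F j - F k) ^ 2 / 2 else 0)
      = ∑ j ∈ Finset.range (N + 1), (F (j + 1) - F j) ^ 2 / 2 := by
    simp only [Finset.sum_ite_eq', Finset.mem_range]
    rw [Finset.sum_range_succ, if_neg (lt_irrefl _), add_zero]
    refine Finset.sum_congr rfl fun j hj => ?_
    rw [if_pos (Nat.succ_lt_succ (Finset.mem_range.1 hj)), ← neg_sq, neg_sub]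
  have hdown : ∑ j ∈ Finset.range (N + 2), ∑ k ∈ Finset.range (N + 2),
      (if j = k + 1 then (F j - F k) ^ 2 / 2 else 0)
      = ∑ j ∈ Finset.range (N + 1), (F (j + 1) - F j) ^ 2 / 2 := by
    rw [Finset.sum_comm, ← hup]
    exact Finset.sum_congr rfl fun j _ => Finset.sum_congr rfl fun k _ => by
      rw [← neg_sq, neg_sub]
  simp only [hpositions, ite_neighbour_eq_add, Finset.sum_add_distrib, hup, hdown,
    ← Finset.sum_div, add_halves]

lemma sum_range_sq_le (hM : 0 < M) (F : ℕ → ℝ) :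
    ∑ k ∈ Finset.range (N + 2), F k ^ 2 ≤ ∑ v : Vertex N M, F (pos v) ^ 2 := by
  rw [← sum_weight_mul hM]
  exact Finset.sum_le_sum fun v _ =>
    mul_le_of_le_one_left (sq_nonneg _) (weight_le_one hM _)

lemma lumped_reservoir_le {f : Vertex N M → ℝ} (hf : f ∈ lumped N M) (hnonneg : 0 ≤ f)
    (σ : Side) (i : Fin M) : f (.inr (σ, i)) ≤ (∑ v, f v) / M := by
  have hM : (0 : ℝ) < M := by exact_mod_cast i.pos
  have hside : ∀ τ : Side, 0 ≤ ∑ j, f (.inr (τ, j)) := fun τ =>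
    Finset.sum_nonneg fun j _ => hnonneg _
  rw [le_div_iff₀ hM]
  calc f (.inr (σ, i)) * M
      = ∑ j, f (.inr (σ, j)) := by
        rw [Finset.sum_congr rfl fun j _ => eq_of_mem_lumped hf
          (show pos (.inr (σ, j)) = pos (.inr (σ, i) : Vertex N M) from rfl)]
        simp [mul_comm]
    _ ≤ ∑ τ, ∑ j, f (.inr (τ, j)) :=
        Finset.single_le_sum (f := fun τ => ∑ j, f (.inr (τ, j))) (fun τ _ => hside τ)
          (Finset.mem_univ σ)
    _ ≤ ∑ v, f v := by
        rw [Fintype.sum_sum_type, Fintype.sum_prod_type]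
        exact le_add_of_nonneg_left (Finset.sum_nonneg fun x _ => hnonneg _)

lemma sq_le_sq_add_two_mul_sqrt (F : ℕ → ℝ) {n p : ℕ} (hp : p ≤ n) :
    F p ^ 2 ≤ F 0 ^ 2 + 2 * √((∑ k ∈ Finset.range (n + 1), F k ^ 2)
      * ∑ k ∈ Finset.range n, (F (k + 1) - F k) ^ 2) := by
  set S := ∑ k ∈ Finset.range (n + 1), F k ^ 2
  set D := ∑ k ∈ Finset.range n, (F (k + 1) - F k) ^ 2
  have hS0 : 0 ≤ S := Finset.sum_nonneg fun _ _ => sq_nonneg _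
  have hD0 : 0 ≤ D := Finset.sum_nonneg fun _ _ => sq_nonneg _
  have hsub : Finset.range p ⊆ Finset.range n := Finset.range_subset_range.2 hp
  have hdiff : ∑ k ∈ Finset.range p, (F (k + 1) - F k) ^ 2 ≤ D :=
    Finset.sum_le_sum_of_subset_of_nonneg hsub fun _ _ _ => sq_nonneg _
  have hadd : ∑ k ∈ Finset.range p, (F (k + 1) + F k) ^ 2 ≤ 4 * S := by
    calc ∑ k ∈ Finset.range p, (F (k + 1) + F k) ^ 2
        ≤ ∑ k ∈ Finset.range n, (F (k + 1) + F k) ^ 2 :=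
          Finset.sum_le_sum_of_subset_of_nonneg hsub fun _ _ _ => sq_nonneg _
      _ ≤ ∑ k ∈ Finset.range n, (2 * F (k + 1) ^ 2 + 2 * F k ^ 2) :=
          Finset.sum_le_sum fun k _ => by nlinarith [sq_nonneg (F (k + 1) - F k)]
      _ ≤ 4 * S := by
          have hfirst : S = _ := Finset.sum_range_succ' (fun k => F k ^ 2) n
          have hlast : S = _ := Finset.sum_range_succ (fun k => F k ^ 2) n
          rw [Finset.sum_add_distrib, ← Finset.mul_sum, ← Finset.mul_sum]
          nlinarith [sq_nonneg (F 0), sq_nonneg (F n)]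
  have htelescope : ∑ k ∈ Finset.range p, (F (k + 1) - F k) * (F (k + 1) + F k)
      = F p ^ 2 - F 0 ^ 2 := by
    rw [← Finset.sum_range_sub (fun k => F k ^ 2)]
    exact Finset.sum_congr rfl fun k _ => by ring
  have hsq : (F p ^ 2 - F 0 ^ 2) ^ 2 ≤ (2 * √(S * D)) ^ 2 := by
    calc (F p ^ 2 - F 0 ^ 2) ^ 2
        ≤ (∑ k ∈ Finset.range p, (F (k + 1) - F k) ^ 2)
            * ∑ k ∈ Finset.range p, (F (k + 1) + F k) ^ 2 :=
          htelescope ▸ Finset.sum_mul_sq_le_sq_mul_sq _ _ _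
      _ ≤ D * (4 * S) := mul_le_mul hdiff hadd (Finset.sum_nonneg fun _ _ => sq_nonneg _) hD0
      _ = (2 * √(S * D)) ^ 2 := by
          rw [mul_pow, Real.sq_sqrt (mul_nonneg hS0 hD0)]
          ring
  linarith [le_of_abs_le (abs_le_of_sq_le_sq hsq (by positivity))]

lemma nash_inequality (hM : 0 < M) {f : Vertex N M → ℝ} (hf : f ∈ lumped N M)
    (hnonneg : 0 ≤ f) (hsum : ∑ v, f v = 1) :
    (∑ v, f v ^ 2) ^ 2 ≤ (1 / (M : ℝ)) ^ 2
      + 2 * √((∑ v, f v ^ 2) * dirichlet (rate N M) f f) := by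
  have hreservoir := lumped_reservoir_le hf hnonneg .left ⟨0, hM⟩
  obtain ⟨F, rfl⟩ := mem_lumped.1 hf
  set B := (1 / (M : ℝ)) ^ 2 + 2 * √((∑ v : Vertex N M, F (pos v) ^ 2)
    * dirichlet (rate N M) (fun v => F (pos v)) fun v => F (pos v)) with hB
  have hB0 : 0 ≤ B := by positivity
  have hF0 : F 0 ^ 2 ≤ (1 / (M : ℝ)) ^ 2 :=
    pow_le_pow_left₀ (hnonneg (.inr (.left, ⟨0, hM⟩))) (hsum ▸ hreservoir) 2
  have hsup : ∀ v : Vertex N M, F (pos v) ≤ √B := fun v => by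
    refine Real.le_sqrt_of_sq_le ((sq_le_sq_add_two_mul_sqrt F (pos_le v)).trans ?_)
    rw [hB, dirichlet_rate_lumped hM]
    gcongr
    exact sum_range_sq_le hM F
  have hle : ∑ v : Vertex N M, F (pos v) ^ 2 ≤ √B := by
    calc ∑ v : Vertex N M, F (pos v) ^ 2
        ≤ ∑ v : Vertex N M, √B * F (pos v) := Finset.sum_le_sum fun v _ => by
          rw [sq]
          exact mul_le_mul_of_nonneg_right (hsup v) (hnonneg v)
      _ = √B := by rw [← Finset.mul_sum, hsum, mul_one]
  exact (pow_le_pow_left₀ (Finset.sum_nonneg fun _ _ => sq_nonneg _) hle 2).trans_eq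
    (Real.sq_sqrt hB0)

end Graph

/-! ### Heat kernel estimates -/

section HeatKernel

lemma le_two_div_sqrt_add_of_sq_le_sqrt_mul {y D : ℝ → ℝ} {t δ : ℝ} (ht : 0 < t) (hδ : 0 ≤ δ)
    (hy : ∀ r ∈ Set.Icc 0 t, HasDerivAt y (-D r) r) (hD : ∀ r ∈ Set.Icc 0 t, 0 ≤ D r)
    (hnash : ∀ r ∈ Set.Icc 0 t, y r ^ 2 ≤ δ ^ 2 + 2 * √(y r * D r)) :
    y t ≤ 2 / √t + 2 * δ := by
  by_contra! hlarge
  have h0 : (0 : ℝ) ∈ Set.Icc 0 t := ⟨le_rfl, ht.le⟩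
  have htt : t ∈ Set.Icc 0 t := ⟨ht.le, le_rfl⟩
  have hsqrt : 0 < 2 / √t := by positivity
  have hanti : AntitoneOn y (Set.Icc 0 t) :=
    antitoneOn_of_hasDerivAt_nonpos hy fun r hr => neg_nonpos.2 (hD r hr)
  have hy_large : ∀ r ∈ Set.Icc 0 t, 2 * δ < y r := fun r hr => by
    linarith [hanti hr htt hr.2]
  have hy_pos : ∀ r ∈ Set.Icc 0 t, 0 < y r := fun r hr => by linarith [hy_large r hr]
  have hD_large : ∀ r ∈ Set.Icc 0 t, 9 / 64 * y r ^ 4 ≤ y r * D r := fun r hr => by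
    have hsq : 3 / 8 * y r ^ 2 ≤ √(y r * D r) := by nlinarith [hnash r hr, hy_large r hr]
    calc 9 / 64 * y r ^ 4 = (3 / 8 * y r ^ 2) ^ 2 := by ring
      _ ≤ √(y r * D r) ^ 2 := pow_le_pow_left₀ (by positivity) hsq 2
      _ = y r * D r := Real.sq_sqrt (mul_nonneg (hy_pos r hr).le (hD r hr))
  have hmono : MonotoneOn (fun r => (y r ^ 2)⁻¹ - 9 / 32 * r) (Set.Icc 0 t) := by
    refine monotoneOn_of_hasDerivAt_nonneg
      (φ' := fun r => -(((2 : ℕ) : ℝ) * y r ^ (2 - 1) * -D r) / (y r ^ 2) ^ 2 - 9 / 32 * 1)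
      (fun r hr => (((hy r hr).pow 2).inv (pow_pos (hy_pos r hr) 2).ne').sub
        ((hasDerivAt_id r).const_mul _)) fun r hr => ?_
    rw [sub_nonneg, le_div_iff₀ (pow_pos (pow_pos (hy_pos r hr) 2) 2)]
    push_cast
    nlinarith [hD_large r hr]
  have hinv_lower : 9 / 32 * t ≤ (y t ^ 2)⁻¹ := by
    have h := hmono h0 htt ht.le
    simp only [mul_zero, sub_zero] at h
    linarith [inv_pos.2 (pow_pos (hy_pos 0 h0) 2)]
  have hinv_upper : (y t ^ 2)⁻¹ < t / 4 := by
    rw [inv_lt_comm₀ (pow_pos (hy_pos t htt) 2) (by positivity), inv_div]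
    calc 4 / t = (2 / √t) ^ 2 := by rw [div_pow, Real.sq_sqrt ht.le]; norm_num
      _ < y t ^ 2 := pow_lt_pow_left₀ (by linarith) hsqrt.le two_ne_zero
  linarith

variable {N M : ℕ}

lemma pos_eq_site_iff {v : Vertex N M} {a : Site N} : pos v = a ↔ v = .inl a := by
  have ha := Finset.mem_Icc.1 a.2
  rcases v with x | ⟨_ | _, i⟩
  · exact Subtype.ext_iff.symm.trans Sum.inl_injective.eq_iff.symm
  all_goals
    simp only [pos, Side.pos, reduceCtorEq, iff_false]
    omega

lemma single_mem_lumped (a : Site N) :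
    (Pi.single (.inl a) 1 : Vertex N M → ℝ) ∈ lumped N M :=
  mem_lumped.2 ⟨fun k => if k = a then 1 else 0, funext fun v => by
    simp only [Pi.single_apply, pos_eq_site_iff]⟩

lemma sum_sq_flow_single_le (hM : 0 < M) (a : Site N) {t : ℝ} (ht : 0 < t) :
    ∑ v : Vertex N M, flow (walkGen (rate N M)) t (Pi.single (.inl a) 1) v ^ 2
      ≤ 2 / √t + 2 / M := by
  set f : ℝ → Vertex N M → ℝ := fun r => flow (walkGen (rate N M)) r (Pi.single (.inl a) 1)
  have hderiv : ∀ r, HasDerivAt (fun r => ∑ v, f r v ^ 2) (-dirichlet (rate N M) (f r) (f r)) r :=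
    fun r => by
      simpa only [Pi.zero_apply, sub_zero] using hasDerivAt_sum_sq_sub rate_symm
        (hasDerivAt_flow_apply (walkGen (rate N M)) (Pi.single (.inl a) 1) r) 0
  calc ∑ v, f t v ^ 2
      ≤ 2 / √t + 2 * (1 / (M : ℝ)) :=
        le_two_div_sqrt_add_of_sq_le_sqrt_mul ht (by positivity) (fun r _ => hderiv r)
          (fun r _ => dirichlet_self_nonneg rate_nonneg _) fun r hr =>
            nash_inequality hM (flow_mem_lumped hM (single_mem_lumped a) hr.1)
              (fun v => (flow_walkGen_single_mem_Icc rate_nonneg hr.1 _ v).1)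
              (sum_flow_walkGen_single rate_nonneg rate_symm hr.1 _)
    _ = 2 / √t + 2 / M := by ring

lemma flow_single_site_le_add (hM : 0 < M) (x : Site N) (v : Vertex N M) {t : ℝ} (ht : 0 < t) :
    flow (walkGen (rate N M)) t (Pi.single v 1) (.inl x) ≤ 2 / √(t / 2) + 2 / M := by
  rcases v with a | ⟨σ, i⟩
  · refine (flow_walkGen_single_le_sum_sq rate_symm t _ _).trans ?_
    linarith [sum_sq_flow_single_le hM a (half_pos ht), sum_sq_flow_single_le hM x (half_pos ht)]
  · have hreservoir := lumped_reservoir_le (flow_mem_lumped hM (single_mem_lumped x) ht.le)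
      (fun v => (flow_walkGen_single_mem_Icc rate_nonneg ht.le _ v).1) σ i
    rw [sum_flow_walkGen_single rate_nonneg rate_symm ht.le] at hreservoir
    rw [flow_walkGen_single_comm rate_symm]
    calc _ ≤ 1 / (M : ℝ) := hreservoir
      _ ≤ 2 / M := by gcongr; exact one_le_two
      _ ≤ 2 / √(t / 2) + 2 / M := le_add_of_nonneg_left (by positivity)

lemma flow_single_site_le (hM : 0 < M) (x : Site N) (v : Vertex N M) {t : ℝ} (ht : 0 ≤ t) :
    flow (walkGen (rate N M)) t (Pi.single v 1) (.inl x) ≤ √(32 / (1 + t) + 8 / (M : ℝ) ^ 2) := by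
  set p := flow (walkGen (rate N M)) t (Pi.single v 1) (.inl x)
  have hp : p ∈ Set.Icc (0 : ℝ) 1 := flow_walkGen_single_mem_Icc rate_nonneg ht v _
  refine Real.le_sqrt_of_sq_le ?_
  rcases lt_or_ge t 1 with ht1 | ht1
  · calc p ^ 2 ≤ 1 := pow_le_one₀ hp.1 hp.2
      _ ≤ 32 / (1 + t) := by rw [le_div_iff₀ (by linarith)]; linarith
      _ ≤ 32 / (1 + t) + 8 / (M : ℝ) ^ 2 := le_add_of_nonneg_right (by positivity)
  · have ht0 : 0 < t := by linarith
    calc p ^ 2 ≤ (2 / √(t / 2) + 2 / M) ^ 2 :=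
          pow_le_pow_left₀ hp.1 (flow_single_site_le_add hM x v ht0) 2
      _ ≤ 2 * ((2 / √(t / 2)) ^ 2 + (2 / M) ^ 2) := add_sq_le
      _ = 16 / t + 8 / (M : ℝ) ^ 2 := by
          rw [div_pow, div_pow, Real.sq_sqrt (by positivity)]
          field_simp
          ring
      _ ≤ 32 / (1 + t) + 8 / (M : ℝ) ^ 2 := by
          gcongr ?_ + _
          rw [div_le_div_iff₀ ht0 (by linarith)]
          linarith

/-- The indicator function of the channel. -/
def channel (N M : ℕ) (v : Vertex N M) : ℝ := if pos v ∈ Finset.Icc 1 N then 1 else 0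

lemma channel_site (x : Site N) : channel N M (.inl x) = 1 := if_pos x.2

lemma channel_reservoir (z : Side × Fin M) : channel N M (.inr z) = 0 := by
  rcases z with ⟨_ | _, i⟩ <;> simp [channel, pos, Side.pos]

lemma channel_mem_lumped : channel N M ∈ lumped N M :=
  mem_lumped.2 ⟨fun k => if k ∈ Finset.Icc 1 N then 1 else 0, rfl⟩

lemma channel_mem_Icc (v : Vertex N M) : channel N M v ∈ Set.Icc (0 : ℝ) 1 := by
  unfold channel
  split_ifs <;> simp

lemma sum_channel : ∑ v, channel N M v = N := by
  rw [Fintype.sum_sum_type]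
  simp [channel_site, channel_reservoir]

lemma flow_channel_reservoir_le (hM : 0 < M) {r : ℝ} (hr : 0 ≤ r) (z : Side × Fin M) :
    flow (walkGen (rate N M)) r (channel N M) (.inr z) ≤ N / M := by
  have h := lumped_reservoir_le (N := N) (flow_mem_lumped hM channel_mem_lumped hr)
    (fun v => (flow_walkGen_mem_Icc rate_nonneg channel_mem_Icc hr v).1) z.1 z.2
  rwa [sum_flow_walkGen rate_nonneg rate_symm _ hr, sum_channel] at h

/-- Up to a constant, the mean exit time of the walk from the channel. -/
def exitTime (N k : ℕ) : ℝ := k * (N + 1 - k)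

lemma exitTime_nonneg (v : Vertex N M) : 0 ≤ exitTime N (pos v) := by
  have : (pos v : ℝ) ≤ N + 1 := by exact_mod_cast pos_le v
  exact mul_nonneg (by positivity) (by linarith)

lemma walkGen_exitTime (hM : 0 < M) (a b : ℝ) (x : Site N) :
    walkGen (rate N M) (fun v => a + exitTime N (pos v) / b) (.inl x) = -(1 / b) := by
  have hpred : (((x : ℕ) - 1 : ℕ) : ℝ) = x - 1 := by
    exact_mod_cast Nat.cast_pred (R := ℝ) (Finset.mem_Icc.1 x.2).1
  rw [walkGen_rate_site hM (fun k => a + exitTime N k / b)]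
  simp only [exitTime, hpred]
  push_cast
  ring

lemma flow_channel_le (hM : 0 < M) (x : Site N) {s : ℝ} (hs : 0 < s) :
    flow (walkGen (rate N M)) s (channel N M) (.inl x) ≤ N / M + exitTime N x / s := by
  set f : ℝ → Vertex N M → ℝ := fun r => flow (walkGen (rate N M)) r (channel N M)
  set h : ℝ → Vertex N M → ℝ := fun r v => (N : ℝ) / M + (1 - r / s) + exitTime N (pos v) / s
  have hf_deriv : ∀ r, HasDerivAt f (walkGen (rate N M) (f r)) r :=
    hasDerivAt_flow_apply _ _
  have hh_deriv : ∀ r, HasDerivAt h (fun _ => -(1 / s)) r := fun r => hasDerivAt_pi.2 fun v =>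
    ((((hasDerivAt_id r).div_const s).const_sub 1).const_add ((N : ℝ) / M)).add_const
      (exitTime N (pos v) / s)
  have hexit : ∀ v : Vertex N M, 0 ≤ exitTime N (pos v) / s := fun v =>
    div_nonneg (exitTime_nonneg v) hs.le
  have hle := parabolic_maximum_principle (isMetzler_walkGen rate_nonneg)
    (Set.range (Sum.inl : Site N → Vertex N M)) hs.le
    (fun r _ => (hf_deriv r).sub (hh_deriv r))
    (by
      rintro r - _ ⟨y, rfl⟩
      rw [Pi.sub_apply f h, map_sub, Pi.sub_apply, Pi.sub_apply, walkGen_exitTime hM])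
    (by
      rintro r hr (y | z) hz
      · exact absurd ⟨y, rfl⟩ hz
      · have : r / s ≤ 1 := (div_le_one hs).2 hr.2
        have := flow_channel_reservoir_le (N := N) hM hr.1 z
        simp only [Pi.sub_apply, f, h]
        linarith [hexit (.inr z)])
    (by
      rintro _ ⟨y, rfl⟩
      have : (0 : ℝ) ≤ N / M := by positivity
      simp only [Pi.sub_apply, f, h, flow_zero, one_apply_eq_self, channel_site, zero_div]
      linarith [hexit (.inl y)])
    (.inl x)
  simp only [Pi.sub_apply, Pi.zero_apply, h, div_self hs.ne', sub_self, add_zero] at hle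
  exact sub_nonpos.1 hle

end HeatKernel

/-! ### Propagation of correlations -/

section Energy

variable {V : Type*} [Fintype V] {c : V → V → ℝ}

lemma dirichlet_self_le_add (hc : ∀ x y, 0 ≤ c x y) (u l : V → ℝ) :
    dirichlet c u u ≤ 2 * dirichlet c u (fun x => u x - l x) + dirichlet c l l := by
  simp only [dirichlet, Finset.mul_sum, ← Finset.sum_add_distrib]
  refine Finset.sum_le_sum fun x _ => Finset.sum_le_sum fun y _ => ?_
  nlinarith [mul_nonneg (hc x y) (sq_nonneg ((u x - u y) - (l x - l y)))]

lemma sub_le_of_neg_mul_dirichlet_le (hc : ∀ x y, 0 ≤ c x y) (hs : ∀ x y, c x y = c y x)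
    {u : ℝ → V → ℝ} {w w' : ℝ → ℝ} {T κ : ℝ} (hT : 0 ≤ T) (hκ : 0 ≤ κ)
    (hu : ∀ r ∈ Set.Icc 0 T, HasDerivAt u (walkGen c (u r)) r)
    (hw : ∀ r ∈ Set.Icc 0 T, HasDerivAt w (w' r) r)
    (hw' : ∀ r ∈ Set.Icc 0 T, -(κ * dirichlet c (u r) (u r)) ≤ w' r) (l : V → ℝ) :
    w 0 - w T ≤ κ * (2 * ∑ x, (u 0 x - l x) ^ 2 + T * dirichlet c l l) := by
  have hmono := monotoneOn_of_hasDerivAt_nonneg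
    (φ := fun r => w r - 2 * κ * ∑ x, (u r x - l x) ^ 2 + κ * dirichlet c l l * r)
    (fun r hr => ((hw r hr).sub ((hasDerivAt_sum_sq_sub hs (hu r hr) l).const_mul _)).add
      ((hasDerivAt_id r).const_mul _))
    (fun r hr => by
      have henergy := mul_le_mul_of_nonneg_left (dirichlet_self_le_add hc (u r) l) hκ
      linarith [hw' r hr])
    ⟨le_rfl, hT⟩ ⟨hT, le_rfl⟩ hT
  have hfinal : 0 ≤ κ * ∑ x, (u T x - l x) ^ 2 := by positivity
  simp only [mul_zero, add_zero] at hmono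
  linarith

lemma dirichlet_self_le (hc : ∀ x y, 0 ≤ c x y) (hs : ∀ x y, c x y = c y x) {u : ℝ → V → ℝ}
    {T : ℝ} (hT : 0 < T) (hu : ∀ r ∈ Set.Icc 0 T, HasDerivAt u (walkGen c (u r)) r) (l : V → ℝ) :
    dirichlet c (u T) (u T) ≤ 2 * (∑ x, (u 0 x - l x) ^ 2) / T + dirichlet c l l := by
  have hle := sub_le_of_neg_mul_dirichlet_le hc hs hT.le zero_le_one hu
    (w := fun r => -dirichlet c (u T) (u T) * r) (fun r _ => (hasDerivAt_id r).const_mul _)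
    (fun r hr => by
      have hanti := antitoneOn_dirichlet_self hs hu hr ⟨hT.le, le_rfl⟩ hr.2
      linarith) l
  calc dirichlet c (u T) (u T) = dirichlet c (u T) (u T) * T / T := by field_simp
    _ ≤ (2 * ∑ x, (u 0 x - l x) ^ 2 + T * dirichlet c l l) / T := by
        gcongr
        linarith
    _ = 2 * (∑ x, (u 0 x - l x) ^ 2) / T + dirichlet c l l := by field_simp

lemma sub_le_of_neg_inv_le {w w' : ℝ → ℝ} {a s A δ : ℝ} (has : a ≤ s)
    (hw : ∀ r ∈ Set.Icc a s, HasDerivAt w (w' r) r)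
    (hw' : ∀ r ∈ Set.Icc a s, -(A / (1 + (s - r)) + δ) ≤ w' r) :
    w a - w s ≤ A * Real.log (1 + (s - a)) + δ * (s - a) := by
  have hlog : ∀ r ∈ Set.Icc a s,
      HasDerivAt (fun r => Real.log (1 + (s - r))) (-1 / (1 + (s - r))) r := fun r hr =>
    (((hasDerivAt_id r).const_sub s).const_add 1).log (by simp only [id_eq]; linarith [hr.2])
  have hmono := monotoneOn_of_hasDerivAt_nonneg
    (φ := fun r => w r - A * Real.log (1 + (s - r)) + δ * r)
    (fun r hr => ((hw r hr).sub ((hlog r hr).const_mul _)).add ((hasDerivAt_id r).const_mul _))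
    (fun r hr => by
      have hdiv : A * (-1 / (1 + (s - r))) = -(A / (1 + (s - r))) := by ring
      linarith [hw' r hr])
    ⟨le_rfl, has⟩ ⟨has, le_rfl⟩ has
  simp only [sub_self, add_zero, Real.log_one, mul_zero, sub_zero] at hmono
  linarith

end Energy

section Correlation

variable {N M : ℕ}

/-- The linear function on `{0, …, N + 1}` with boundary values `a` and `b`. It is the stationary
profile of the density when the reservoirs have densities `a` and `b`. -/
def linearProfile (N : ℕ) (a b : ℝ) (k : ℕ) : ℝ := a + k * ((b - a) / (N + 1))

lemma linearProfile_zero (a b : ℝ) : linearProfile N a b 0 = a := by simp [linearProfile]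

lemma linearProfile_last (a b : ℝ) : linearProfile N a b (N + 1) = b := by
  unfold linearProfile
  push_cast
  field_simp
  ring

lemma linearProfile_mem {s : Set ℝ} (hs : Convex ℝ s) {a b : ℝ} (ha : a ∈ s) (hb : b ∈ s) {k : ℕ}
    (hk : k ≤ N + 1) : linearProfile N a b k ∈ s := by
  have hk' : (k : ℝ) ≤ N + 1 := by exact_mod_cast hk
  have hline := hs.add_smul_sub_mem ha hb (t := k / (N + 1))
    ⟨by positivity, div_le_one_of_le₀ hk' (by positivity)⟩
  rwa [smul_eq_mul, div_mul_eq_mul_div, mul_div_assoc] at hline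

lemma sum_sq_sub_linearProfile_le (hM : 0 < M) {F : ℕ → ℝ}
    (hF : ∀ v : Vertex N M, F (pos v) ∈ Set.Icc (0 : ℝ) 1) :
    ∑ v : Vertex N M, (F (pos v) - linearProfile N (F 0) (F (N + 1)) (pos v)) ^ 2 ≤ N := by
  have hside : ∀ σ : Side, F (σ.pos N) - linearProfile N (F 0) (F (N + 1)) (σ.pos N) = 0 := by
    rintro (_ | _)
    · exact sub_eq_zero.2 (linearProfile_zero _ _).symm
    · exact sub_eq_zero.2 (linearProfile_last _ _).symm
  have hsite : ∀ x : Site N, (F x - linearProfile N (F 0) (F (N + 1)) x) ^ 2 ≤ 1 := fun x => by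
    have hx := hF (.inl x)
    have hl := linearProfile_mem (convex_Icc (0 : ℝ) 1) (hF (.inr (.left, ⟨0, hM⟩)))
      (hF (.inr (.right, ⟨0, hM⟩))) (pos_le (.inl x : Vertex N M))
    exact (sq_le_one_iff_abs_le_one _).2 (abs_sub_le_of_nonneg_of_le hx.1 hx.2 hl.1 hl.2)
  calc ∑ v : Vertex N M, (F (pos v) - linearProfile N (F 0) (F (N + 1)) (pos v)) ^ 2
      = ∑ x : Site N, (F x - linearProfile N (F 0) (F (N + 1)) x) ^ 2 := by
        simp [Fintype.sum_sum_type, pos, hside]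
    _ ≤ ∑ _x : Site N, 1 := Finset.sum_le_sum fun x _ => hsite x
    _ = N := by simp

lemma dirichlet_linearProfile_le (hN : 0 < N) (hM : 0 < M) {a b : ℝ}
    (ha : a ∈ Set.Icc (0 : ℝ) 1) (hb : b ∈ Set.Icc (0 : ℝ) 1) :
    dirichlet (rate N M) (fun v => linearProfile N a b (pos v))
      (fun v => linearProfile N a b (pos v)) ≤ 1 / N := by
  have hstep : ∀ k : ℕ, linearProfile N a b (k + 1) - linearProfile N a b k = (b - a) / (N + 1) :=
    fun k => by
      unfold linearProfile
      push_cast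
      ring
  have hab : (b - a) ^ 2 ≤ 1 :=
    (sq_le_one_iff_abs_le_one _).2 (abs_sub_le_of_nonneg_of_le hb.1 hb.2 ha.1 ha.2)
  rw [dirichlet_rate_lumped hM]
  simp only [hstep, Finset.sum_const, Finset.card_range, nsmul_eq_mul]
  calc ((N + 1 : ℕ) : ℝ) * ((b - a) / ((N : ℝ) + 1)) ^ 2 = (b - a) ^ 2 / ((N : ℝ) + 1) := by
        push_cast
        field_simp
    _ ≤ 1 / (N : ℝ) := div_le_div₀ zero_le_one hab (by positivity) (by linarith)

/-- Bound for the correlations created by the exclusion up to time `s`: the first summand is the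
contribution of the time interval `[0, s / 2]`, the second one that of `[s / 2, s]`. -/
def sourceBound (N M : ℕ) (s : ℝ) : ℝ :=
  4 * ((64 / s + 8 / (M : ℝ) ^ 2) * (2 * N + s / (2 * N))
    + (4 * N / s + 1 / N) * (32 * Real.log (1 + s / 2) + 4 * s / (M : ℝ) ^ 2))

/-- A function `u` which solves the heat equation and a function `K` which solves the evolution
equation of the correlations: the pair equation with a source of strength `-rate * (u a - u b) ^ 2`
on the edges. -/
structure IsCorrelationFlow (u : ℝ → Vertex N M → ℝ) (K : ℝ → Vertex N M × Vertex N M → ℝ) :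
    Prop where
  hasDerivAt_density : ∀ r, HasDerivAt u (walkGen (rate N M) (u r)) r
  hasDerivAt_correlation : ∀ r, HasDerivAt K
    (pairGen (rate N M) (K r) - offDiag fun a b => rate N M a b * (u r a - u r b) ^ 2) r
  lumped_zero : u 0 ∈ lumped N M
  mem_Icc_zero : ∀ v, u 0 v ∈ Set.Icc (0 : ℝ) 1

namespace IsCorrelationFlow

variable {u : ℝ → Vertex N M → ℝ} {K : ℝ → Vertex N M × Vertex N M → ℝ}

lemma exists_profile (h : IsCorrelationFlow u K) (hN : 0 < N) (hM : 0 < M) :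
    ∃ l : Vertex N M → ℝ, ∑ v, (u 0 v - l v) ^ 2 ≤ N ∧ dirichlet (rate N M) l l ≤ 1 / N := by
  obtain ⟨F, hF⟩ := mem_lumped.1 h.lumped_zero
  have hF01 := hF ▸ h.mem_Icc_zero
  exact ⟨fun v => linearProfile N (F 0) (F (N + 1)) (pos v),
    hF ▸ sum_sq_sub_linearProfile_le hM hF01,
    dirichlet_linearProfile_le hN hM (hF01 (.inr (.left, ⟨0, hM⟩)))
      (hF01 (.inr (.right, ⟨0, hM⟩)))⟩

lemma hasDerivAt_flow_sub (h : IsCorrelationFlow u K) (s r : ℝ) (p : Vertex N M × Vertex N M) :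
    HasDerivAt (fun r => flow (pairGen (rate N M)) (s - r) (K r) p)
      (-flow (pairGen (rate N M)) (s - r)
        (offDiag fun a b => rate N M a b * (u r a - u r b) ^ 2) p) r := by
  have hderiv := hasDerivAt_pi.1 (hasDerivAt_flow_sub_apply (pairGen (rate N M)) s r
    (h.hasDerivAt_correlation r)) p
  rwa [sub_sub_cancel_left, map_neg] at hderiv

lemma flow_source_nonneg (u : Vertex N M → ℝ) {t : ℝ} (ht : 0 ≤ t) (p : Vertex N M × Vertex N M) :
    0 ≤ flow (pairGen (rate N M)) t (offDiag fun a b => rate N M a b * (u a - u b) ^ 2) p :=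
  flow_nonneg (isMetzler_pairGen rate_nonneg) ht
    (offDiag_nonneg fun a b => mul_nonneg (rate_nonneg a b) (sq_nonneg _)) p

lemma flow_source_le (hM : 0 < M) (u : Vertex N M → ℝ) {t : ℝ} (ht : 0 ≤ t) {x y : Site N}
    (hxy : x ≠ y) :
    flow (pairGen (rate N M)) t (offDiag fun a b => rate N M a b * (u a - u b) ^ 2)
      (.inl x, .inl y) ≤ 4 * (32 / (1 + t) + 8 / (M : ℝ) ^ 2) * dirichlet (rate N M) u u := by
  have hle := flow_pairGen_source_le rate_nonneg rate_symm u ht (Sum.inl_injective.ne hxy)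
    (fun v => flow_single_site_le hM x v ht) (fun v => flow_single_site_le hM y v ht)
  rwa [Real.sq_sqrt (by positivity)] at hle

lemma flow_le_add_first_half (h : IsCorrelationFlow u K) (hN : 0 < N) (hM : 0 < M) {s : ℝ}
    (hs : 0 < s) {x y : Site N} (hxy : x ≠ y) :
    flow (pairGen (rate N M)) s (K 0) (.inl x, .inl y)
      ≤ flow (pairGen (rate N M)) (s / 2) (K (s / 2)) (.inl x, .inl y)
        + 4 * ((64 / s + 8 / (M : ℝ) ^ 2) * (2 * N + s / (2 * N))) := by
  obtain ⟨l, hsum, hdirichlet⟩ := h.exists_profile hN hM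
  have hle := sub_le_of_neg_mul_dirichlet_le rate_nonneg rate_symm (half_pos hs).le
    (κ := 4 * (64 / s + 8 / (M : ℝ) ^ 2)) (by positivity) (fun r _ => h.hasDerivAt_density r)
    (fun r _ => h.hasDerivAt_flow_sub s r (.inl x, .inl y))
    (fun r hr => by
      refine neg_le_neg ((flow_source_le hM (u r) (by linarith [hr.2]) hxy).trans ?_)
      gcongr ?_ * (?_ + _) * _
      · exact dirichlet_self_nonneg rate_nonneg _
      · rw [div_le_div_iff₀ (by linarith [hr.2]) hs]
        linarith [hr.2]) l
  rw [sub_zero, sub_half] at hle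
  rw [← sub_le_iff_le_add']
  refine hle.trans ?_
  rw [mul_assoc]
  gcongr
  calc s / 2 * dirichlet (rate N M) l l ≤ s / 2 * (1 / N) := by gcongr
    _ = s / (2 * N) := by field_simp

lemma le_add_second_half (h : IsCorrelationFlow u K) (hN : 0 < N) (hM : 0 < M) {s : ℝ}
    (hs : 0 < s) {x y : Site N} (hxy : x ≠ y) :
    flow (pairGen (rate N M)) (s / 2) (K (s / 2)) (.inl x, .inl y)
      ≤ K s (.inl x, .inl y) + 4 * ((4 * N / s + 1 / N)
        * (32 * Real.log (1 + s / 2) + 4 * s / (M : ℝ) ^ 2)) := by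
  obtain ⟨l, hsum, hdirichlet⟩ := h.exists_profile hN hM
  set E : ℝ := 4 * N / s + 1 / N with hE
  have henergy : dirichlet (rate N M) (u (s / 2)) (u (s / 2)) ≤ E :=
    calc _ ≤ 2 * (∑ v, (u 0 v - l v) ^ 2) / (s / 2) + dirichlet (rate N M) l l :=
          dirichlet_self_le rate_nonneg rate_symm (half_pos hs)
            (fun r _ => h.hasDerivAt_density r) l
      _ ≤ 2 * N / (s / 2) + 1 / N := by gcongr
      _ = E := by
          rw [hE]
          ring
  have hle := sub_le_of_neg_inv_le (half_le_self hs.le)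
    (fun r _ => h.hasDerivAt_flow_sub s r (.inl x, .inl y)) (A := 4 * 32 * E)
    (δ := 4 * 8 / (M : ℝ) ^ 2 * E)
    (fun r hr => by
      have hsr : 0 ≤ s - r := sub_nonneg.2 hr.2
      have hanti : dirichlet (rate N M) (u r) (u r) ≤ E :=
        (antitoneOn_dirichlet_self rate_symm (fun r _ => h.hasDerivAt_density r)
          ⟨le_rfl, hr.1⟩ ⟨hr.1, le_rfl⟩ hr.1).trans henergy
      refine neg_le_neg ((flow_source_le hM (u r) hsr hxy).trans ?_)
      calc _ ≤ 4 * (32 / (1 + (s - r)) + 8 / (M : ℝ) ^ 2) * E := by gcongr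
        _ = _ := by ring)
  rw [sub_half, sub_self, flow_zero, one_apply_eq_self, sub_le_iff_le_add'] at hle
  exact hle.trans_eq (by ring)

lemma abs_sub_flow_le_sourceBound (h : IsCorrelationFlow u K) (hN : 0 < N) (hM : 0 < M) {s : ℝ}
    (hs : 0 < s) {x y : Site N} (hxy : x ≠ y) :
    |K s (.inl x, .inl y) - flow (pairGen (rate N M)) s (K 0) (.inl x, .inl y)|
      ≤ sourceBound N M s := by
  have hanti := antitoneOn_of_hasDerivAt_nonpos
    (fun r _ => h.hasDerivAt_flow_sub s r (.inl x, .inl y))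
    (fun r hr => neg_nonpos.2 (flow_source_nonneg (u r) (sub_nonneg.2 hr.2) _))
    (Set.left_mem_Icc.2 hs.le) (Set.right_mem_Icc.2 hs.le) hs.le
  simp only [sub_self, sub_zero, flow_zero, one_apply_eq_self] at hanti
  have hfirst := h.flow_le_add_first_half hN hM hs hxy
  have hsecond := h.le_add_second_half hN hM hs hxy
  rw [abs_of_nonpos (sub_nonpos.2 hanti), sourceBound, mul_add]
  linarith

end IsCorrelationFlow

lemma abs_flow_offDiag_le (hM : 0 < M) {k : Vertex N M → Vertex N M → ℝ} {κ β : ℝ} (hβ : 0 ≤ β)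
    (hk : ∀ a b, a ≠ b → |k a b| ≤ κ + β * (channel N M a + channel N M b)) {s : ℝ} (hs : 0 < s)
    {x y : Site N} (hxy : x ≠ y) :
    |flow (pairGen (rate N M)) s (offDiag k) (.inl x, .inl y)|
      ≤ κ + β * (2 * (N / M) + (exitTime N x + exitTime N y) / s) := by
  have hA := isMetzler_pairGen (rate_nonneg (N := N) (M := M))
  set B : Vertex N M × Vertex N M → ℝ := offDiag (fun _ _ => κ)
    + β • offDiag (fun a b => channel N M a + channel N M b) with hB
  have hB_apply : ∀ a b, a ≠ b → B (a, b) = κ + β * (channel N M a + channel N M b) :=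
    fun a b hab => by
      rw [hB, Pi.add_apply, Pi.smul_apply, offDiag_of_ne _ hab, offDiag_of_ne _ hab, smul_eq_mul]
  have hB_eq : B = offDiag fun a b => κ + β * (channel N M a + channel N M b) := by
    funext ⟨a, b⟩
    by_cases hab : a = b
    · simp [hB, hab, offDiag_self]
    · rw [hB_apply a b hab, offDiag_of_ne _ hab]
  have hupper : offDiag k ≤ B := hB_eq ▸ offDiag_mono fun a b hab => le_of_abs_le (hk a b hab)
  have hlower : -B ≤ offDiag k := by
    rintro ⟨a, b⟩
    by_cases hab : a = b
    · simp [hB_eq, hab, offDiag_self]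
    · rw [Pi.neg_apply, hB_apply a b hab, offDiag_of_ne _ hab]
      exact neg_le_of_abs_le (hk a b hab)
  have hflow : |flow (pairGen (rate N M)) s (offDiag k) (.inl x, .inl y)|
      ≤ flow (pairGen (rate N M)) s B (.inl x, .inl y) := by
    have h := flow_mono hA hs.le hlower (.inl x, .inl y)
    rw [map_neg, Pi.neg_apply] at h
    exact abs_le.2 ⟨h, flow_mono hA hs.le hupper (.inl x, .inl y)⟩
  refine hflow.trans ?_
  rw [hB, map_add, map_smul, flow_pairGen_const rate_nonneg _ hs.le,
    flow_pairGen_add rate_nonneg rate_symm _ hs.le, Pi.add_apply, Pi.smul_apply, smul_eq_mul,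
    offDiag_of_ne _ (Sum.inl_injective.ne hxy), offDiag_of_ne _ (Sum.inl_injective.ne hxy), add_div]
  have hx := flow_channel_le hM x hs
  have hy := flow_channel_le hM y hs
  gcongr κ + β * ?_
  linarith

end Correlation

/-! ### Duality -/

section Stirring

variable {V : Type*} [DecidableEq V]

lemma swap_apply_sub (f : V → ℝ) (i j x : V) : f (Equiv.swap i j x) - f x =
    (if i = x then f j - f x else 0) + (if j = x then f i - f x else 0) := by
  rw [Equiv.swap_apply_def]
  grind

lemma swap_apply_swap_apply_sub {F : V → V → ℝ} (hF : ∀ a b, F a b = F b a) (i j : V) {x y : V}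
    (hxy : x ≠ y) : F (Equiv.swap i j x) (Equiv.swap i j y) - F x y =
      ((if i = x then (if j = y then 0 else F j y - F x y) else 0)
        + (if j = x then (if i = y then 0 else F i y - F x y) else 0))
      + ((if i = y then (if j = x then 0 else F x j - F x y) else 0)
        + (if j = y then (if i = x then 0 else F x i - F x y) else 0)) := by
  rw [Equiv.swap_apply_def, Equiv.swap_apply_def]
  grind

variable [Fintype V]

lemma sum_sum_mul_ite_add (b : V → V → ℝ) (x : V) (g : V → ℝ) :
    ∑ i, ∑ j, b i j * ((if i = x then g j else 0) + (if j = x then g i else 0))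
      = ∑ z, (b x z + b z x) * g z := by
  simp only [mul_add, Finset.sum_add_distrib, mul_ite, mul_zero, add_mul]
  congr 1
  · rw [Finset.sum_comm]
    simp
  · simp

lemma sum_mul_swap_apply_sub (b : V → V → ℝ) (f : V → ℝ) (x : V) :
    ∑ i, ∑ j, b i j * (f (Equiv.swap i j x) - f x) = walkGen (fun v w => b v w + b w v) f x := by
  simp only [swap_apply_sub]
  rw [sum_sum_mul_ite_add b x fun z => f z - f x, walkGen_apply]

lemma sum_mul_swap_apply_swap_apply_sub (b : V → V → ℝ) {F : V → V → ℝ}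
    (hF : ∀ a b, F a b = F b a) {x y : V} (hxy : x ≠ y) :
    ∑ i, ∑ j, b i j * (F (Equiv.swap i j x) (Equiv.swap i j y) - F x y)
      = pairGen (fun v w => b v w + b w v) (offDiag F) (x, y) := by
  simp only [swap_apply_swap_apply_sub hF _ _ hxy]
  simp only [mul_add (b _ _) (_ + _) (_ + _), Finset.sum_add_distrib]
  rw [sum_sum_mul_ite_add b x fun z => if z = y then 0 else F z y - F x y,
    sum_sum_mul_ite_add b y fun z => if z = x then 0 else F x z - F x y,
    pairGen_apply_of_ne _ _ hxy, offDiag_of_ne _ hxy]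
  congr 1 <;> refine Finset.sum_congr rfl fun z _ => ?_
  · by_cases hz : z = y
    · simp [hz]
    · rw [if_neg hz, if_neg hz, offDiag_of_ne _ hz]
  · by_cases hz : z = x
    · simp [hz]
    · rw [if_neg hz, if_neg hz, offDiag_of_ne _ (Ne.symm hz)]

lemma pairGen_rate_add (c d : V → V → ℝ) (F : V × V → ℝ) (p : V × V) :
    pairGen (c + d) F p = pairGen c F p + pairGen d F p := by
  obtain ⟨x, y⟩ := p
  by_cases h : x = y
  · simp [h, pairGen_apply_self]
  · simp only [pairGen_apply_of_ne _ _ h, sum_ite_eq_zero_else, Pi.add_apply, add_mul,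
      Finset.sum_add_distrib]
    ring

lemma pairGen_offDiag_comm (c : V → V → ℝ) {F : V → V → ℝ} (hF : ∀ a b, F a b = F b a) (x y : V) :
    pairGen c (offDiag F) (x, y) = pairGen c (offDiag F) (y, x) := by
  by_cases h : x = y
  · rw [h]
  · rw [pairGen_offDiag_of_ne c F h, pairGen_offDiag_of_ne c F (Ne.symm h), add_comm]
    simp only [hF _ x, hF y]

lemma pairGen_offDiag_of_isolated {c F : V → V → ℝ} {f : V → ℝ} {e : ℝ} {x y : V} (hxy : x ≠ y)
    (hcxy : c x y = 0) (hc : ∀ z, c y z = 0)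
    (hF : ∀ z, c x z * (F z y - F x y) = c x z * (f z - f x) * e) :
    pairGen c (offDiag F) (x, y) = walkGen c f x * e := by
  rw [pairGen_offDiag_of_ne c F hxy]
  simp only [walkGen_apply, hcxy, hc, hF, Finset.sum_mul, zero_mul, Finset.sum_const_zero, sub_zero,
    add_zero]

end Stirring

section Boundary

variable {M : ℕ}

/-- The density of a reservoir with `n` particles. -/
def reservoirDensity (n : Fin (M + 1)) : ℝ := (n : ℕ) / (M : ℝ)

/-- The probability that two distinct vertices of a reservoir are both occupied, if its `n`
particles are placed uniformly at random on its `M` vertices. -/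
def pairDensity (n : Fin (M + 1)) : ℝ := (n : ℕ) * ((n : ℕ) - 1) / ((M : ℝ) * (M - 1))

variable (b : Bool) (n : Fin (M + 1))

-- The truncations in `reservoirMove` can be ignored: they are only met when the rate vanishes.
lemma boundaryRate_mul_reservoirMove (hM : 0 < M) (g : ℝ → ℝ) :
    boundaryRate (occ b) (reservoirDensity n) * g (reservoirMove b n : ℕ)
      = boundaryRate (occ b) (reservoirDensity n) * g ((n : ℕ) + (2 * occ b - 1)) := by
  rcases b with _ | _
  · rcases Nat.eq_zero_or_pos (n : ℕ) with hn | hn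
    · simp [boundaryRate, occ, reservoirDensity, hn]
    · simp [reservoirMove, occ, Nat.cast_pred hn, sub_eq_add_neg]
  · rcases (Fin.is_le n).eq_or_lt with hn | hn
    · simp [boundaryRate, occ, reservoirDensity, hn, hM.ne']
    · have hmin : min ((n : ℕ) + 1) M = n + 1 := min_eq_left hn
      norm_num [reservoirMove, occ, hmin]

lemma boundaryRate_mul_occ_not_sub (d : ℝ) :
    boundaryRate (occ b) d * (occ (!b) - occ b) = 1 / 2 * (d - occ b) := by
  cases b <;> simp [boundaryRate, occ]
  ring

lemma boundaryRate_mul_reservoirDensity_sub (hM : 0 < M) :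
    boundaryRate (occ b) (reservoirDensity n)
        * (reservoirDensity (reservoirMove b n) - reservoirDensity n)
      = 1 / (2 * M) * (occ b - reservoirDensity n) := by
  refine (boundaryRate_mul_reservoirMove b n hM fun k => k / M - reservoirDensity n).trans ?_
  cases b <;> simp only [boundaryRate, occ, reservoirDensity, if_true, Bool.false_eq_true, if_false]
    <;> field_simp <;> ring

lemma boundaryRate_mul_pairDensity_sub (hM : 2 ≤ M) :
    boundaryRate (occ b) (reservoirDensity n) * (pairDensity (reservoirMove b n) - pairDensity n)
      = 1 / M * (occ b * reservoirDensity n - pairDensity n) := by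
  have hM1 : (M : ℝ) - 1 ≠ 0 := (sub_pos.2 (by exact_mod_cast hM)).ne'
  refine (boundaryRate_mul_reservoirMove b n (by positivity)
    fun k => k * (k - 1) / ((M : ℝ) * (M - 1)) - pairDensity n).trans ?_
  cases b <;> simp only [boundaryRate, occ, reservoirDensity, pairDensity, if_true,
    Bool.false_eq_true, if_false] <;> field_simp <;> ring

lemma boundaryRate_mul_occ_mul_reservoirDensity_sub (hM : 2 ≤ M) :
    boundaryRate (occ b) (reservoirDensity n)
        * (occ (!b) * reservoirDensity (reservoirMove b n) - occ b * reservoirDensity n)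
      = (M - 1) / (2 * M) * (pairDensity n - occ b * reservoirDensity n) := by
  have hM1 : (M : ℝ) - 1 ≠ 0 := (sub_pos.2 (by exact_mod_cast hM)).ne'
  refine (boundaryRate_mul_reservoirMove b n (by positivity)
    fun k => occ (!b) * (k / M) - occ b * reservoirDensity n).trans ?_
  cases b <;> simp only [boundaryRate, occ, reservoirDensity, pairDensity, if_true, Bool.not_false,
    Bool.not_true, Bool.false_eq_true, if_false] <;> field_simp <;> ring

end Boundary

section Duality

variable {N M : ℕ}

/-- The number of particles in a reservoir. -/
def Side.particles : Side → Config N M → Fin (M + 1)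
  | left, ω => ω.2.1
  | right, ω => ω.2.2

/-- The exchange of a particle between a site and a reservoir. -/
def Side.move : Side → Config N M → Site N → Config N M
  | left => leftMove
  | right => rightMove

lemma Side.move_fst (σ : Side) (ω : Config N M) (a : Site N) :
    (σ.move ω a).1 = Function.update ω.1 a (!ω.1 a) := by
  cases σ <;> rfl

lemma Side.particles_move_self (σ : Side) (ω : Config N M) (a : Site N) :
    σ.particles (σ.move ω a) = reservoirMove (ω.1 a) (σ.particles ω) := by
  cases σ <;> rfl

lemma Side.particles_move_of_ne {σ τ : Side} (h : τ ≠ σ) (ω : Config N M) (a : Site N) :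
    τ.particles (σ.move ω a) = τ.particles ω := by
  cases σ <;> cases τ <;> first | rfl | exact absurd rfl h

/-- The probability that a vertex is occupied, given the configuration. -/
def density (ω : Config N M) : Vertex N M → ℝ
  | .inl x => occ (ω.1 x)
  | .inr z => reservoirDensity (z.1.particles ω)

/-- The probability that two distinct vertices are both occupied, given the configuration. -/
def density₂ (ω : Config N M) : Vertex N M → Vertex N M → ℝ
  | .inr z, .inr z' => if z.1 = z'.1 then pairDensity (z.1.particles ω)
      else density ω (.inr z) * density ω (.inr z')
  | v, w => density ω v * density ω w

lemma density₂_site_left (ω : Config N M) (x : Site N) (w : Vertex N M) :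
    density₂ ω (.inl x) w = occ (ω.1 x) * density ω w := rfl

lemma density₂_reservoir_self (ω : Config N M) (σ : Side) (i j : Fin M) :
    density₂ ω (.inr (σ, i)) (.inr (σ, j)) = pairDensity (σ.particles ω) := if_pos rfl

lemma density₂_reservoir_of_ne (ω : Config N M) {z z' : Side × Fin M} (h : z.1 ≠ z'.1) :
    density₂ ω (.inr z) (.inr z') = density ω (.inr z) * density ω (.inr z') := if_neg h

lemma density₂_comm (ω : Config N M) (v w : Vertex N M) : density₂ ω v w = density₂ ω w v := by
  rcases v with x | ⟨σ, i⟩ <;> rcases w with y | ⟨τ, j⟩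
  · exact mul_comm _ _
  · exact mul_comm _ _
  · exact mul_comm _ _
  · rcases eq_or_ne σ τ with rfl | h
    · rfl
    · rw [density₂_reservoir_of_ne ω h, density₂_reservoir_of_ne ω h.symm, mul_comm]

/-- The part of the generator which belongs to the channel. -/
def bulkGen (f : Config N M → ℝ) (ω : Config N M) : ℝ :=
  (1 / 2) * ∑ x : Site N, ∑ y : Site N,
    if (y : ℕ) = (x : ℕ) + 1 then f (exchange ω x y) - f ω else 0

/-- Each edge of the channel carries the rate `1 / 2`, in the direction from left to right. -/
def edgeRate : Vertex N M → Vertex N M → ℝ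
  | .inl x, .inl y => if (y : ℕ) = x + 1 then 1 / 2 else 0
  | _, _ => 0

/-- The part of the stirring rates which belongs to the channel. -/
def bulkRate (v w : Vertex N M) : ℝ := edgeRate v w + edgeRate w v

lemma swap_inl_inl_inl (i j x : Site N) :
    Equiv.swap (.inl i : Vertex N M) (.inl j) (.inl x) = .inl (Equiv.swap i j x) :=
  (Sum.inl_injective.map_swap i j x).symm

lemma swap_inl_inl_inr (i j : Site N) (z : Side × Fin M) :
    Equiv.swap (.inl i : Vertex N M) (.inl j) (.inr z) = .inr z :=
  Equiv.swap_apply_of_ne_of_ne Sum.inr_ne_inl Sum.inr_ne_inl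

lemma density_exchange (ω : Config N M) (i j : Site N) (v : Vertex N M) :
    density (exchange ω i j) v = density ω (Equiv.swap (.inl i) (.inl j) v) := by
  rcases v with x | ⟨_ | _, k⟩
  · rw [swap_inl_inl_inl]
    rfl
  all_goals
    rw [swap_inl_inl_inr]
    rfl

lemma density₂_exchange (ω : Config N M) (i j : Site N) (v w : Vertex N M) :
    density₂ (exchange ω i j) v w
      = density₂ ω (Equiv.swap (.inl i) (.inl j) v) (Equiv.swap (.inl i) (.inl j) w) := by
  have hproduct : ∀ x : Site N, ∀ w, density₂ (exchange ω i j) (.inl x) w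
      = density₂ ω (Equiv.swap (.inl i) (.inl j) (.inl x)) (Equiv.swap (.inl i) (.inl j) w) :=
    fun x w => by
      rw [swap_inl_inl_inl, density₂_site_left, density₂_site_left, density_exchange]
      rfl
  rcases v with x | ⟨_ | _, k⟩ <;> rcases w with y | ⟨_ | _, l⟩
  all_goals first
    | exact hproduct _ _
    | rw [density₂_comm, hproduct, density₂_comm]
    | rw [swap_inl_inl_inr, swap_inl_inl_inr]; rfl

lemma bulkGen_eq_sum_swap {f : Config N M → ℝ} {ω : Config N M}
    {g : Equiv.Perm (Vertex N M) → ℝ}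
    (hg : ∀ i j, f (exchange ω i j) = g (Equiv.swap (.inl i) (.inl j))) :
    bulkGen f ω = ∑ v, ∑ w, edgeRate v w * (g (Equiv.swap v w) - f ω) := by
  simp only [Fintype.sum_sum_type, edgeRate, zero_mul, Finset.sum_const_zero, add_zero, ← hg,
    bulkGen, Finset.mul_sum, mul_ite, mul_zero, ite_mul]

lemma bulkGen_density (ω : Config N M) (v : Vertex N M) :
    bulkGen (fun ω => density ω v) ω = walkGen bulkRate (density ω) v :=
  (bulkGen_eq_sum_swap (g := fun π => density ω (π v)) fun i j => density_exchange ω i j v).trans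
    (sum_mul_swap_apply_sub _ _ _)

lemma bulkGen_density₂ (ω : Config N M) {v w : Vertex N M} (hvw : v ≠ w) :
    bulkGen (fun ω => density₂ ω v w) ω = pairGen bulkRate (offDiag (density₂ ω)) (v, w) :=
  (bulkGen_eq_sum_swap (g := fun π => density₂ ω (π v) (π w))
    fun i j => density₂_exchange ω i j v w).trans
    (sum_mul_swap_apply_swap_apply_sub _ (density₂_comm ω) hvw)

/-- The part of the generator which belongs to a reservoir attached to the site `a`. -/
def boundaryGen (σ : Side) (a : Site N) (f : Config N M → ℝ) (ω : Config N M) : ℝ :=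
  boundaryRate (occ (ω.1 a)) (reservoirDensity (σ.particles ω)) * (f (σ.move ω a) - f ω)

/-- The stirring rates between the site `a` and the vertices of a reservoir. -/
def reservoirRate (σ : Side) (a : Site N) : Vertex N M → Vertex N M → ℝ
  | .inl x, .inr z | .inr z, .inl x => if x = a ∧ z.1 = σ then 1 / (2 * M) else 0
  | _, _ => 0

/-- The vertices involved in the exchange between the site `a` and a reservoir. -/
def IsExchanged (σ : Side) (a : Site N) : Vertex N M → Prop
  | .inl x => x = a
  | .inr z => z.1 = σ

variable {σ : Side} {a : Site N} {v w : Vertex N M}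

lemma reservoirRate_comm (σ : Side) (a : Site N) (v w : Vertex N M) :
    reservoirRate σ a v w = reservoirRate σ a w v := by
  rcases v with x | z <;> rcases w with y | z' <;> rfl

lemma reservoirRate_of_not_isExchanged (hv : ¬IsExchanged σ a v) (w : Vertex N M) :
    reservoirRate σ a v w = 0 := by
  rcases v with x | z <;> rcases w with y | z'
  · rfl
  · exact if_neg fun h => hv h.1
  · exact if_neg fun h => hv h.2
  · rfl

lemma walkGen_reservoirRate_of_not_isExchanged (hv : ¬IsExchanged σ a v) (f : Vertex N M → ℝ) :
    walkGen (reservoirRate σ a) f v = 0 := by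
  simp only [walkGen_apply, reservoirRate_of_not_isExchanged hv, zero_mul, Finset.sum_const_zero]

lemma walkGen_reservoirRate_site (σ : Side) (a : Site N) (f : Vertex N M → ℝ) :
    walkGen (reservoirRate σ a) f (.inl a)
      = ∑ i : Fin M, 1 / (2 * M) * (f (.inr (σ, i)) - f (.inl a)) := by
  simp [walkGen_apply, reservoirRate, Fintype.sum_prod_type_right]

lemma walkGen_reservoirRate_reservoir (σ : Side) (a : Site N) (f : Vertex N M → ℝ) (i : Fin M) :
    walkGen (reservoirRate σ a) f (.inr (σ, i))
      = 1 / (2 * M) * (f (.inl a) - f (.inr (σ, i))) := by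
  simp [walkGen_apply, reservoirRate]

lemma density_move_site (σ : Side) (a : Site N) (ω : Config N M) :
    density (σ.move ω a) (.inl a) = occ (!ω.1 a) := by
  simp only [density, Side.move_fst, Function.update_self]

lemma density_move_of_not_isExchanged (hv : ¬IsExchanged σ a v) (ω : Config N M) :
    density (σ.move ω a) v = density ω v := by
  rcases v with x | z
  · simp only [density, Side.move_fst, Function.update_of_ne hv]
  · simp only [density, Side.particles_move_of_ne hv]

lemma density₂_of_isExchanged_of_not (hv : IsExchanged σ a v) (hw : ¬IsExchanged σ a w)
    (ω : Config N M) : density₂ ω v w = density ω v * density ω w := by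
  rcases v with x | z <;> rcases w with y | z'
  · rfl
  · rfl
  · rfl
  · exact if_neg fun h => hw (h.symm.trans hv)

lemma density₂_move_of_not_isExchanged (hv : ¬IsExchanged σ a v) (hw : ¬IsExchanged σ a w)
    (ω : Config N M) : density₂ (σ.move ω a) v w = density₂ ω v w := by
  have hv' := density_move_of_not_isExchanged hv ω
  have hw' := density_move_of_not_isExchanged hw ω
  rcases v with x | z <;> rcases w with y | z'
  · simp only [density₂, hv', hw']
  · simp only [density₂, hv', hw']
  · simp only [density₂, hv', hw']
  · simp only [density₂, hv', hw', Side.particles_move_of_ne hv]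

lemma boundaryGen_density (hM : 0 < M) (σ : Side) (a : Site N) (ω : Config N M) (v : Vertex N M) :
    boundaryGen σ a (fun ω => density ω v) ω = walkGen (reservoirRate σ a) (density ω) v := by
  by_cases hv : IsExchanged σ a v
  · rcases v with x | ⟨τ, i⟩
    · obtain rfl : x = a := hv
      rw [walkGen_reservoirRate_site, boundaryGen, density_move_site]
      refine (boundaryRate_mul_occ_not_sub _ _).trans ?_
      simp only [density, Finset.sum_const, Finset.card_univ, Fintype.card_fin, nsmul_eq_mul]
      field_simp
    · obtain rfl : τ = σ := hv
      rw [walkGen_reservoirRate_reservoir, boundaryGen]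
      simp only [density, Side.particles_move_self]
      exact boundaryRate_mul_reservoirDensity_sub _ _ hM
  · rw [walkGen_reservoirRate_of_not_isExchanged hv, boundaryGen,
      density_move_of_not_isExchanged hv, sub_self, mul_zero]

lemma boundaryGen_density₂_of_not_isExchanged (hM : 0 < M) (ω : Config N M) (hvw : v ≠ w)
    (hw : ¬IsExchanged σ a w) :
    boundaryGen σ a (fun ω => density₂ ω v w) ω
      = pairGen (reservoirRate σ a) (offDiag (density₂ ω)) (v, w) := by
  have hrate := reservoirRate_of_not_isExchanged (M := M) hw
  by_cases hv : IsExchanged σ a v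
  · have hproduct : ∀ z, reservoirRate σ a v z * (density₂ ω z w - density₂ ω v w)
        = reservoirRate σ a v z * (density ω z - density ω v) * density ω w := by
      intro z
      by_cases hz : IsExchanged σ a z
      · rw [density₂_of_isExchanged_of_not hz hw, density₂_of_isExchanged_of_not hv hw]
        ring
      · rw [reservoirRate_comm, reservoirRate_of_not_isExchanged hz]
        ring
    rw [pairGen_offDiag_of_isolated hvw (by rw [reservoirRate_comm, hrate]) hrate hproduct,
      ← boundaryGen_density hM, boundaryGen, boundaryGen, density₂_of_isExchanged_of_not hv hw,
      density₂_of_isExchanged_of_not hv hw, density_move_of_not_isExchanged hw]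
    ring
  · have hzero := reservoirRate_of_not_isExchanged (M := M) hv
    rw [pairGen_offDiag_of_isolated (f := density ω) (e := 0) hvw (hzero w) hrate
      fun z => by rw [hzero]; ring, boundaryGen, density₂_move_of_not_isExchanged hv hw]
    ring

lemma boundaryGen_density₂_site_reservoir (hM : 2 ≤ M) (σ : Side) (a : Site N) (ω : Config N M)
    (i : Fin M) :
    boundaryGen σ a (fun ω => density₂ ω (.inl a) (.inr (σ, i))) ω
      = pairGen (reservoirRate σ a) (offDiag (density₂ ω)) (.inl a, .inr (σ, i)) := by
  have hM' : (M : ℝ) ≠ 0 := by positivity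
  rw [pairGen_offDiag_of_ne _ _ Sum.inl_ne_inr, walkGen_reservoirRate_site,
    walkGen_reservoirRate_reservoir, boundaryGen]
  simp only [density₂_reservoir_self, density₂_site_left, Finset.sum_const, Finset.card_univ,
    Fintype.card_fin, nsmul_eq_mul, reservoirRate, and_self, if_true, density,
    Side.particles_move_self, Side.move_fst, Function.update_self]
  rw [boundaryRate_mul_occ_mul_reservoirDensity_sub _ _ hM]
  field_simp
  ring

lemma boundaryGen_density₂_reservoir (hM : 2 ≤ M) (σ : Side) (a : Site N) (ω : Config N M)
    {i j : Fin M} (hij : i ≠ j) :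
    boundaryGen σ a (fun ω => density₂ ω (.inr (σ, i)) (.inr (σ, j))) ω
      = pairGen (reservoirRate σ a) (offDiag (density₂ ω)) (.inr (σ, i), .inr (σ, j)) := by
  rw [pairGen_offDiag_of_ne _ _ (by simpa using hij), walkGen_reservoirRate_reservoir,
    walkGen_reservoirRate_reservoir, boundaryGen, density₂_comm ω _ (.inl a)]
  simp only [density₂_reservoir_self, density₂_site_left, reservoirRate, density,
    Side.particles_move_self]
  rw [boundaryRate_mul_pairDensity_sub _ _ hM]
  ring

lemma boundaryGen_density₂ (hM : 2 ≤ M) (σ : Side) (a : Site N) (ω : Config N M) (hvw : v ≠ w) :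
    boundaryGen σ a (fun ω => density₂ ω v w) ω
      = pairGen (reservoirRate σ a) (offDiag (density₂ ω)) (v, w) := by
  have hM' : 0 < M := by positivity
  by_cases hw : IsExchanged σ a w
  swap
  · exact boundaryGen_density₂_of_not_isExchanged hM' ω hvw hw
  by_cases hv : IsExchanged σ a v
  swap
  · rw [pairGen_offDiag_comm _ (density₂_comm ω),
      ← boundaryGen_density₂_of_not_isExchanged hM' ω hvw.symm hv]
    simp only [density₂_comm _ w]
  rcases v with x | ⟨τ, i⟩ <;> rcases w with y | ⟨τ', j⟩
  · exact absurd (hv.trans hw.symm) fun h => hvw (congrArg _ h)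
  · obtain rfl : x = a := hv
    obtain rfl : τ' = σ := hw
    exact boundaryGen_density₂_site_reservoir hM _ _ ω j
  · obtain rfl : y = a := hw
    obtain rfl : τ = σ := hv
    rw [pairGen_offDiag_comm _ (density₂_comm ω), ← boundaryGen_density₂_site_reservoir hM]
    simp only [density₂_comm _ (.inr _)]
  · obtain rfl : τ = σ := hv
    obtain rfl : τ' = τ := hw
    exact boundaryGen_density₂_reservoir hM _ _ ω fun h => hvw (by rw [h])

/-- The site of the channel to which a reservoir is attached. -/
def Side.endSite (hN : 0 < N) : Side → Site N
  | left => ⟨1, Finset.mem_Icc.2 ⟨le_rfl, hN⟩⟩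
  | right => ⟨N, Finset.mem_Icc.2 ⟨hN, le_rfl⟩⟩

lemma sum_ite_val_eq (a : Site N) (g : Site N → ℝ) :
    (∑ x : Site N, if (x : ℕ) = a then g x else 0) = g a := by
  simp only [Subtype.val_inj, Finset.sum_ite_eq', Finset.mem_univ, if_true]

lemma gen_apply (hN : 0 < N) (f : Config N M → ℝ) (ω : Config N M) :
    gen N M f ω = bulkGen f ω + boundaryGen .right (Side.right.endSite hN) f ω
      + boundaryGen .left (Side.left.endSite hN) f ω := by
  refine congrArg₂ (fun p q : ℝ => p + q) (congrArg (fun p : ℝ => bulkGen f ω + p) ?_) ?_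
  · exact sum_ite_val_eq (Side.right.endSite hN) _
  · exact sum_ite_val_eq (Side.left.endSite hN) _

lemma rate_site_site (x y : Site N) :
    rate N M (.inl x) (.inl y) = bulkRate (.inl x : Vertex N M) (.inl y) := by
  simp only [rate, pos, weight_of_mem x.2, weight_of_mem y.2, bulkRate, edgeRate,
    ite_neighbour_eq_add]
  norm_num

lemma rate_site_reservoir (hN : 0 < N) (x : Site N) (z : Side × Fin M) :
    rate N M (.inl x) (.inr z) = reservoirRate z.1 (z.1.endSite hN) (.inl x) (.inr z) := by
  have hx := Finset.mem_Icc.1 x.2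
  simp only [rate, pos, weight_of_mem x.2, weight_side_pos, reservoirRate, and_true]
  have hadjacent : (z.1.pos N = x + 1 ∨ (x : ℕ) = z.1.pos N + 1) ↔ x = z.1.endSite hN := by
    rw [← Subtype.val_inj]
    rcases z with ⟨_ | _, i⟩ <;> simp only [Side.pos, Side.endSite] <;> omega
  rw [one_mul, div_div, mul_comm (M : ℝ)]
  exact if_congr hadjacent rfl rfl

lemma rate_eq (hN : 0 < N) : rate N M = bulkRate + reservoirRate .right (Side.right.endSite hN)
    + reservoirRate .left (Side.left.endSite hN) := by
  have hsum : ∀ (x : Site N) (z : Side × Fin M),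
      reservoirRate z.1 (z.1.endSite hN) (.inl x) (.inr z)
        = reservoirRate .right (Side.right.endSite hN) (.inl x) (.inr z)
          + reservoirRate .left (Side.left.endSite hN) (.inl x) (.inr z) := by
    rintro x ⟨_ | _, i⟩ <;> simp [reservoirRate]
  ext v w
  rcases v with x | z <;> rcases w with y | z'
  · simp [rate_site_site, reservoirRate]
  · simp [rate_site_reservoir hN, hsum, bulkRate, edgeRate]
  · rw [rate_symm, rate_site_reservoir hN, hsum]
    simp [bulkRate, edgeRate, reservoirRate]
  · rcases z with ⟨_ | _, i⟩ <;> rcases z' with ⟨_ | _, j⟩ <;>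
      simp [rate, pos, Side.pos, bulkRate, edgeRate, reservoirRate] <;> omega

lemma gen_density (hN : 0 < N) (hM : 0 < M) (v : Vertex N M) :
    gen N M (fun ω => density ω v) = fun ω => walkGen (rate N M) (density ω) v := by
  ext ω
  rw [gen_apply hN, bulkGen_density, boundaryGen_density hM, boundaryGen_density hM, rate_eq hN,
    walkGen_rate_add, walkGen_rate_add]

lemma gen_density₂ (hN : 0 < N) (hM : 2 ≤ M) (hvw : v ≠ w) :
    gen N M (fun ω => density₂ ω v w)
      = fun ω => pairGen (rate N M) (offDiag (density₂ ω)) (v, w) := by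
  ext ω
  rw [gen_apply hN, bulkGen_density₂ ω hvw, boundaryGen_density₂ hM _ _ ω hvw,
    boundaryGen_density₂ hM _ _ ω hvw, rate_eq hN, pairGen_rate_add, pairGen_rate_add]

end Duality

/-! ### Correlations of the particle system -/

section LinearFunctional

variable {Ω V : Type*} [Fintype V]

lemma map_walkGen (φ : (Ω → ℝ) →ₗ[ℝ] ℝ) (c : V → V → ℝ) (f : Ω → V → ℝ) (x : V) :
    φ (fun ω => walkGen c (f ω) x) = walkGen c (fun z => φ fun ω => f ω z) x := by
  have hsum : (fun ω => walkGen c (f ω) x)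
      = ∑ z, c x z • ((fun ω => f ω z) - fun ω => f ω x) := by
    ext ω
    simp [walkGen_apply]
  rw [hsum, map_sum, walkGen_apply]
  simp only [map_smul, map_sub, smul_eq_mul]

lemma map_pairGen_offDiag [DecidableEq V] (φ : (Ω → ℝ) →ₗ[ℝ] ℝ) (c : V → V → ℝ)
    (F : Ω → V → V → ℝ) {x y : V} (hxy : x ≠ y) :
    φ (fun ω => pairGen c (offDiag (F ω)) (x, y))
      = pairGen c (offDiag fun a b => φ fun ω => F ω a b) (x, y) := by
  have hsum : (fun ω => pairGen c (offDiag (F ω)) (x, y))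
      = (fun ω => walkGen c (fun z => F ω z y) x)
          - c x y • ((fun ω => F ω y y) - fun ω => F ω x y)
        + ((fun ω => walkGen c (fun z => F ω x z) y)
          - c y x • ((fun ω => F ω x x) - fun ω => F ω x y)) := by
    ext ω
    rw [pairGen_offDiag_of_ne _ _ hxy]
    rfl
  rw [hsum, pairGen_offDiag_of_ne _ _ hxy]
  simp only [map_add, map_sub, map_smul, smul_eq_mul, map_walkGen]

end LinearFunctional

section Covariance

variable {Ω : Type*} [Fintype Ω] {μ : Ω → ℝ}

lemma dotProduct_mem_Icc (hμ : μ ∈ stdSimplex ℝ Ω) {X : Ω → ℝ} {a b : ℝ}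
    (hX : ∀ ω, X ω ∈ Set.Icc a b) : μ ⬝ᵥ X ∈ Set.Icc a b :=
  (convex_Icc a b).sum_mem (fun ω _ => hμ.1 ω) hμ.2 fun ω _ => hX ω

lemma dotProduct_const (hμ : μ ∈ stdSimplex ℝ Ω) (a : ℝ) : (μ ⬝ᵥ fun _ => a) = a := by
  rw [dotProduct, ← Finset.sum_mul, hμ.2, one_mul]

lemma abs_dotProduct_le (hμ : 0 ≤ μ) {X Y : Ω → ℝ} (h : ∀ ω, |X ω| ≤ Y ω) :
    |μ ⬝ᵥ X| ≤ μ ⬝ᵥ Y := by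
  refine (Finset.abs_sum_le_sum_abs _ _).trans (Finset.sum_le_sum fun ω _ => ?_)
  rw [abs_mul, abs_of_nonneg (hμ ω)]
  exact mul_le_mul_of_nonneg_left (h ω) (hμ ω)

lemma abs_covariance_le (hμ : μ ∈ stdSimplex ℝ Ω) {X : Ω → ℝ} (hX : ∀ ω, X ω ∈ Set.Icc (0 : ℝ) 1)
    (Y : Ω → ℝ) (v : ℝ) :
    |(μ ⬝ᵥ fun ω => X ω * Y ω) - μ ⬝ᵥ X * μ ⬝ᵥ Y| ≤ 2 * (μ ⬝ᵥ fun ω => |Y ω - v|) := by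
  have hshift : (μ ⬝ᵥ fun ω => X ω * Y ω) - μ ⬝ᵥ X * μ ⬝ᵥ Y
      = (μ ⬝ᵥ fun ω => X ω * (Y ω - v)) - μ ⬝ᵥ X * (μ ⬝ᵥ fun ω => Y ω - v) := by
    have hmean : (μ ⬝ᵥ fun ω => Y ω - v) = μ ⬝ᵥ Y - v := by
      rw [← dotProduct_const hμ v, ← dotProduct_sub, dotProduct_const hμ]
      rfl
    have hproduct : (μ ⬝ᵥ fun ω => X ω * (Y ω - v)) = (μ ⬝ᵥ fun ω => X ω * Y ω) - μ ⬝ᵥ X * v := by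
      simp only [dotProduct, Finset.sum_mul, ← Finset.sum_sub_distrib, mul_sub, mul_assoc]
    rw [hmean, hproduct]
    ring
  have hX01 := dotProduct_mem_Icc hμ hX
  have hproduct : |μ ⬝ᵥ fun ω => X ω * (Y ω - v)| ≤ μ ⬝ᵥ fun ω => |Y ω - v| :=
    abs_dotProduct_le hμ.1 fun ω => by
      rw [abs_mul, abs_of_nonneg (hX ω).1]
      exact mul_le_of_le_one_left (abs_nonneg _) (hX ω).2
  have hmean := abs_dotProduct_le (X := fun ω => Y ω - v) hμ.1 fun ω => le_rfl
  calc _ ≤ |μ ⬝ᵥ fun ω => X ω * (Y ω - v)| + |μ ⬝ᵥ X * (μ ⬝ᵥ fun ω => Y ω - v)| :=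
        hshift ▸ abs_sub _ _
    _ ≤ (μ ⬝ᵥ fun ω => |Y ω - v|) + 1 * (μ ⬝ᵥ fun ω => |Y ω - v|) := by
        rw [abs_mul, abs_of_nonneg hX01.1]
        exact add_le_add hproduct (mul_le_mul hX01.2 hmean (abs_nonneg _) zero_le_one)
    _ = _ := by ring

end Covariance

section Expectation

variable {N M : ℕ}

/-- The expectation at time `s` as a linear functional. -/
def expectLinear (μ : Config N M → ℝ) (s : ℝ) : (Config N M → ℝ) →ₗ[ℝ] ℝ :=
  dotProductBilin ℝ ℝ μ ∘ₗ (semigroup N M s).toLinearMap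

lemma hasDerivAt_expect (μ f : Config N M → ℝ) (s : ℝ) :
    HasDerivAt (fun s => expect μ s f) (expect μ s (gen N M f)) s := by
  have hflow := hasDerivAt_flow_apply (LinearMap.toContinuousLinearMap (gen N M)) f s
  rw [← flow_apply_comm] at hflow
  exact HasDerivAt.fun_sum fun ω _ => (hasDerivAt_pi.1 hflow ω).const_mul (μ ω)

lemma expect_zero (μ f : Config N M → ℝ) : expect μ 0 f = μ ⬝ᵥ f := by
  have h : semigroup N M 0 = 1 := flow_zero (LinearMap.toContinuousLinearMap (gen N M))
  simp only [expect, h, one_apply_eq_self, dotProduct]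

/-- The mean densities at the vertices at time `s`. -/
def meanDensity (μ : Config N M → ℝ) (s : ℝ) (v : Vertex N M) : ℝ :=
  expect μ s fun ω => density ω v

/-- The correlation of two distinct vertices at time `s`. -/
def pairCorrelation (μ : Config N M → ℝ) (s : ℝ) (v w : Vertex N M) : ℝ :=
  expect μ s (fun ω => density₂ ω v w) - meanDensity μ s v * meanDensity μ s w

lemma hasDerivAt_meanDensity (hN : 0 < N) (hM : 0 < M) (μ : Config N M → ℝ) (s : ℝ) :
    HasDerivAt (meanDensity μ) (walkGen (rate N M) (meanDensity μ s)) s := by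
  refine hasDerivAt_pi.2 fun v => ?_
  have hexpect := hasDerivAt_expect μ (fun ω => density ω v) s
  rw [gen_density hN hM] at hexpect
  exact hexpect.congr_deriv (map_walkGen (expectLinear μ s) _ density v)

lemma hasDerivAt_expect_density₂ (hN : 0 < N) (hM : 2 ≤ M) (μ : Config N M → ℝ) (s : ℝ)
    {v w : Vertex N M} (hvw : v ≠ w) : HasDerivAt (fun s => expect μ s fun ω => density₂ ω v w)
      (pairGen (rate N M) (offDiag fun a b => expect μ s fun ω => density₂ ω a b) (v, w)) s := by
  have hexpect := hasDerivAt_expect μ (fun ω => density₂ ω v w) s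
  rw [gen_density₂ hN hM hvw] at hexpect
  exact hexpect.congr_deriv (map_pairGen_offDiag (expectLinear μ s) _ density₂ hvw)

lemma hasDerivAt_pairCorrelation (hN : 0 < N) (hM : 2 ≤ M) (μ : Config N M → ℝ) (s : ℝ) :
    HasDerivAt (fun s => offDiag (pairCorrelation μ s))
      (pairGen (rate N M) (offDiag (pairCorrelation μ s))
        - offDiag fun a b => rate N M a b * (meanDensity μ s a - meanDensity μ s b) ^ 2) s := by
  have hmean := hasDerivAt_pi.1 (hasDerivAt_meanDensity hN (by positivity) μ s)
  refine (hasDerivAt_offDiag fun a b hab => (hasDerivAt_expect_density₂ hN hM μ s hab).sub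
    ((hmean a).mul (hmean b))).congr_deriv (Eq.symm ?_)
  have hsub : offDiag (pairCorrelation μ s)
      = (offDiag fun a b => expect μ s fun ω => density₂ ω a b)
        - offDiag fun a b => meanDensity μ s a * meanDensity μ s b := by
    funext p
    simp only [pairCorrelation, offDiag, Pi.sub_apply]
    split_ifs <;> ring
  rw [hsub, map_sub, pairGen_offDiag_mul rate_symm]
  funext ⟨a, b⟩
  by_cases hab : a = b
  · simp [hab, offDiag_self, pairGen_apply_self]
  · simp only [Pi.sub_apply, offDiag_of_ne _ hab]
    ring

lemma eta_eq_density (x : Site N) (ω : Config N M) : eta x ω = density ω (.inl x) :=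
  dif_pos x.2

lemma correlation_eq_pairCorrelation (μ : Config N M → ℝ) (s : ℝ) (x y : Site N) :
    correlation μ s x y = pairCorrelation μ s (.inl x) (.inl y) := by
  simp only [correlation, eta_eq_density, funext fun ω : Config N M => eta_eq_density x ω,
    funext fun ω : Config N M => eta_eq_density y ω]
  rfl

lemma occ_mem_Icc (b : Bool) : occ b ∈ Set.Icc (0 : ℝ) 1 := by
  cases b <;> simp [occ]

lemma reservoirDensity_mem_Icc (n : Fin (M + 1)) : reservoirDensity n ∈ Set.Icc (0 : ℝ) 1 := by
  have h : ((n : ℕ) : ℝ) ≤ M := by exact_mod_cast Fin.is_le n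
  exact ⟨by unfold reservoirDensity; positivity, div_le_one_of_le₀ h (by positivity)⟩

lemma density_mem_Icc (ω : Config N M) (v : Vertex N M) : density ω v ∈ Set.Icc (0 : ℝ) 1 := by
  rcases v with x | z
  · exact occ_mem_Icc _
  · exact reservoirDensity_mem_Icc _

lemma density_eq_of_pos_eq (ω : Config N M) {v w : Vertex N M} (h : pos v = pos w) :
    density ω v = density ω w := by
  rcases v with x | ⟨_ | _, i⟩ <;> rcases w with y | ⟨_ | _, j⟩ <;>
    simp only [pos, Side.pos] at h
  any_goals rfl
  · rw [Subtype.ext h]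
  all_goals
    exfalso
    first
    | have := Finset.mem_Icc.1 x.2
      omega
    | have := Finset.mem_Icc.1 y.2
      omega
    | omega

variable {μ : Config N M → ℝ}

lemma isCorrelationFlow (hN : 0 < N) (hM : 2 ≤ M) (hμ : μ ∈ stdSimplex ℝ (Config N M)) :
    IsCorrelationFlow (meanDensity μ) fun s => offDiag (pairCorrelation μ s) where
  hasDerivAt_density := hasDerivAt_meanDensity hN (by positivity) μ
  hasDerivAt_correlation := hasDerivAt_pairCorrelation hN hM μ
  lumped_zero := mem_lumped_of_forall fun v w h => by
    simp only [meanDensity, density_eq_of_pos_eq _ h]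
  mem_Icc_zero v := by
    rw [meanDensity, expect_zero]
    exact dotProduct_mem_Icc hμ fun ω => density_mem_Icc ω v

lemma abs_pairDensity_sub_le (hM : 2 ≤ M) (n : Fin (M + 1)) :
    |pairDensity n - reservoirDensity n * reservoirDensity n| ≤ 1 / ((M : ℝ) - 1) := by
  have hM' : (2 : ℝ) ≤ M := by exact_mod_cast hM
  have hM1 : (0 : ℝ) < M - 1 := by linarith
  have hdiff : pairDensity n - reservoirDensity n * reservoirDensity n
      = -(reservoirDensity n * (1 - reservoirDensity n) / (M - 1)) := by
    have := hM1.ne'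
    unfold pairDensity reservoirDensity
    field_simp
    ring
  obtain ⟨h0, h1⟩ := reservoirDensity_mem_Icc n
  have hnonneg : 0 ≤ reservoirDensity n * (1 - reservoirDensity n) :=
    mul_nonneg h0 (sub_nonneg.2 h1)
  rw [hdiff, abs_neg, abs_of_nonneg (div_nonneg hnonneg hM1.le)]
  exact div_le_div_of_nonneg_right (by nlinarith) hM1.le

lemma one_div_sub_one_nonneg (hM : 2 ≤ M) : 0 ≤ 1 / ((M : ℝ) - 1) := by
  have : (2 : ℝ) ≤ M := by exact_mod_cast hM
  exact one_div_nonneg.2 (by linarith)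

lemma abs_density₂_sub_le (hM : 2 ≤ M) (ω : Config N M) (v w : Vertex N M) :
    |density₂ ω v w - density ω v * density ω w| ≤ 1 / ((M : ℝ) - 1) := by
  rcases v with x | ⟨σ, i⟩ <;> rcases w with y | ⟨τ, j⟩
  any_goals simpa [density₂] using one_div_sub_one_nonneg hM
  rcases eq_or_ne σ τ with rfl | h
  · rw [density₂_reservoir_self]
    exact abs_pairDensity_sub_le hM _
  · rw [density₂_reservoir_of_ne ω h, sub_self, abs_zero]
    exact one_div_sub_one_nonneg hM

/-- Bound for the initial correlations of the vertices of a reservoir: the mean deviation of its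
density from `v`, and an error term for the exclusion in the reservoir. -/
def reservoirError (μ : Config N M → ℝ) (σ : Side) (v : ℝ) : ℝ :=
  2 * (μ ⬝ᵥ fun ω => |reservoirDensity (σ.particles ω) - v|) + 1 / ((M : ℝ) - 1)

lemma reservoirError_nonneg (hM : 2 ≤ M) (hμ : 0 ≤ μ) (σ : Side) (v : ℝ) :
    0 ≤ reservoirError μ σ v :=
  add_nonneg (mul_nonneg zero_le_two (dotProduct_nonneg_of_nonneg hμ fun _ => abs_nonneg _))
    (one_div_sub_one_nonneg hM)

lemma reservoirError_le_sum (hM : 2 ≤ M) (hμ : 0 ≤ μ) (v : Side → ℝ) (τ : Side) :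
    reservoirError μ τ (v τ) ≤ ∑ σ, reservoirError μ σ (v σ) :=
  Finset.single_le_sum (f := fun σ => reservoirError μ σ (v σ))
    (fun σ _ => reservoirError_nonneg hM hμ σ _) (Finset.mem_univ τ)

lemma abs_pairCorrelation_zero_reservoir_le (hM : 2 ≤ M) (hμ : μ ∈ stdSimplex ℝ (Config N M))
    (a : Vertex N M) (z : Side × Fin M) (v : ℝ) :
    |pairCorrelation μ 0 a (.inr z)| ≤ reservoirError μ z.1 v := by
  have hcov := abs_covariance_le hμ (fun ω => density_mem_Icc ω a) (density · (.inr z)) v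
  have hexclusion := abs_dotProduct_le
    (X := (density₂ · a (.inr z)) - fun ω => density ω a * density ω (.inr z)) hμ.1
    fun ω => abs_density₂_sub_le hM ω a (.inr z)
  rw [dotProduct_const hμ, dotProduct_sub] at hexclusion
  simp only [pairCorrelation, meanDensity, expect_zero]
  refine (abs_sub_le _ (μ ⬝ᵥ fun ω => density ω a * density ω (.inr z)) _).trans ?_
  rw [add_comm]
  exact add_le_add hcov hexclusion

lemma abs_correlation_zero_le_one (hμ : μ ∈ stdSimplex ℝ (Config N M)) (x y : Site N) :
    |correlation μ 0 x y| ≤ 1 := by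
  rw [correlation_eq_pairCorrelation, pairCorrelation, meanDensity, meanDensity]
  simp only [expect_zero]
  have hx := dotProduct_mem_Icc hμ fun ω => density_mem_Icc ω (.inl x)
  have hy := dotProduct_mem_Icc hμ fun ω => density_mem_Icc ω (.inl y)
  have hxy := dotProduct_mem_Icc hμ fun ω =>
    unitInterval.mul_mem (density_mem_Icc ω (.inl x)) (density_mem_Icc ω (.inl y))
  have hmul := unitInterval.mul_mem hx hy
  exact abs_sub_le_of_le_of_le hxy.1 hxy.2 hmul.1 hmul.2 |>.trans_eq (sub_zero 1)

lemma abs_correlation_le (hN : 0 < N) (hM : 2 ≤ M) (hμ : μ ∈ stdSimplex ℝ (Config N M))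
    {v : Side → ℝ} {δ ε β : ℝ} (hδ : ∀ σ, reservoirError μ σ (v σ) ≤ δ) (hε : 0 ≤ ε) (hβ : 0 ≤ β)
    (h0 : ∀ x y : Site N, x ≠ y → |correlation μ 0 x y| ≤ ε + 2 * β) {s : ℝ} (hs : 0 < s)
    {x y : Site N} (hxy : x ≠ y) :
    |correlation μ s x y| ≤ ε + δ + β * (2 * (N / M) + (exitTime N x + exitTime N y) / s)
      + sourceBound N M s := by
  have hM' : 0 < M := by positivity
  have hreservoir : ∀ a z, |pairCorrelation μ 0 a (.inr z)| ≤ δ := fun a z =>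
    (abs_pairCorrelation_zero_reservoir_le hM hμ a z (v z.1)).trans (hδ z.1)
  have hδ0 : 0 ≤ δ := (abs_nonneg _).trans (hreservoir (.inl x) (.left, ⟨0, hM'⟩))
  have hinitial : ∀ a b, a ≠ b →
      |pairCorrelation μ 0 a b| ≤ (ε + δ) + β * (channel N M a + channel N M b) := by
    intro a b hab
    have hchannel : 0 ≤ β * (channel N M a + channel N M b) :=
      mul_nonneg hβ (add_nonneg (channel_mem_Icc a).1 (channel_mem_Icc b).1)
    rcases b with b | z
    · rcases a with a | z
      · rw [channel_site, channel_site, ← correlation_eq_pairCorrelation]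
        linarith [h0 a b fun h => hab (congrArg _ h)]
      · have hcomm : pairCorrelation μ 0 (.inr z) (.inl b)
            = pairCorrelation μ 0 (.inl b) (.inr z) := by
          simp only [pairCorrelation, density₂_comm _ (.inr z), mul_comm]
        linarith [hcomm ▸ hreservoir (.inl b) z]
    · linarith [hreservoir a z]
  have hsource := (isCorrelationFlow hN hM hμ).abs_sub_flow_le_sourceBound hN hM' hs hxy
  have hflow := abs_flow_offDiag_le hM' hβ hinitial hs hxy
  rw [offDiag_of_ne _ fun h => hxy (Sum.inl_injective h)] at hsource
  rw [correlation_eq_pairCorrelation]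
  linarith [abs_sub_abs_le_abs_sub (pairCorrelation μ s (.inl x) (.inl y))
    (flow (pairGen (rate N M)) s (offDiag (pairCorrelation μ 0)) (.inl x, .inl y))]

end Expectation

/-! ### Long channels -/

section Asymptotics

variable {N M : ℕ}

lemma dotProduct_abs_le_add_prob {μ : Config N M → ℝ} (hμ : μ ∈ stdSimplex ℝ (Config N M))
    {X : Config N M → ℝ} {C : ℝ} (hX : ∀ ω, |X ω| ≤ C) {δ : ℝ} (hδ : 0 ≤ δ) :
    (μ ⬝ᵥ fun ω => |X ω|) ≤ δ + C * prob μ fun ω => δ < |X ω| := by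
  refine le_trans ?_ (add_le_add (dotProduct_const hμ δ).le le_rfl)
  rw [dotProduct, dotProduct, prob, Finset.mul_sum, ← Finset.sum_add_distrib]
  refine Finset.sum_le_sum fun ω _ => ?_
  split_ifs with h
  · rw [mul_comm C]
    exact le_add_of_nonneg_of_le (mul_nonneg (hμ.1 ω) hδ)
      (mul_le_mul_of_nonneg_left (hX ω) (hμ.1 ω))
  · rw [mul_zero, add_zero]
    exact mul_le_mul_of_nonneg_left (not_lt.1 h) (hμ.1 ω)

variable {m : ℕ → ℕ} {μ : (N : ℕ) → Config N (m N) → ℝ}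

lemma tendsto_dotProduct_abs (hμ : ∀ N, μ N ∈ stdSimplex ℝ (Config N (m N)))
    {X : (N : ℕ) → Config N (m N) → ℝ} {C : ℝ} (hX : ∀ N ω, |X N ω| ≤ C)
    (h : ∀ δ > 0, Tendsto (fun N => prob (μ N) fun ω => δ < |X N ω|) atTop (𝓝 0)) :
    Tendsto (fun N => μ N ⬝ᵥ fun ω => |X N ω|) atTop (𝓝 0) := by
  refine tendsto_order.2 ⟨fun a ha => .of_forall fun N => ha.trans_le ?_, fun δ hδ => ?_⟩
  · exact Finset.sum_nonneg fun ω _ => mul_nonneg ((hμ N).1 ω) (abs_nonneg _)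
  · have hprob := (h (δ / 2) (half_pos hδ)).const_mul C
    rw [mul_zero] at hprob
    filter_upwards [hprob.eventually_lt_const (half_pos hδ)] with N hN
    linarith [dotProduct_abs_le_add_prob (hμ N) (hX N) (half_pos hδ).le]

lemma tendsto_reservoirError (hm : Tendsto m atTop atTop)
    (hμ : ∀ N, μ N ∈ stdSimplex ℝ (Config N (m N))) {σ : Side} {v : ℝ}
    (h : ∀ δ > 0, Tendsto
      (fun N => prob (μ N) fun ω => δ < |reservoirDensity (σ.particles ω) - v|) atTop (𝓝 0)) :
    Tendsto (fun N => reservoirError (μ N) σ v) atTop (𝓝 0) := by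
  have hdeviation := tendsto_dotProduct_abs hμ (C := 1 + |v|) (fun N ω => by
    have hdensity := reservoirDensity_mem_Icc (σ.particles ω)
    exact (abs_sub _ _).trans (by rw [abs_of_nonneg hdensity.1]; gcongr; exact hdensity.2)) h
  have hexclusion : Tendsto (fun N => 1 / ((m N : ℝ) - 1)) atTop (𝓝 0) :=
    (tendsto_atTop_add_const_right _ (-1 : ℝ)
      (tendsto_natCast_atTop_atTop.comp hm)).const_div_atTop 1
  simpa [reservoirError] using (hdeviation.const_mul 2).add hexclusion

lemma sourceBound_eq {s : ℝ} (hN : 0 < N) (hs : 0 < s) :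
    sourceBound N M s = 4 * (128 * (N / s) + 32 * (1 / N) + 32 * (N / M ^ 2)
      + 8 * (s / (N * M ^ 2)) + 32 * (4 * (N ^ 2 / s) + 1) * (Real.log (1 + s / 2) / N)) := by
  have : (0 : ℝ) < N := by exact_mod_cast hN
  simp only [sourceBound, div_eq_mul_inv, mul_inv]
  generalize ((M : ℝ) ^ 2)⁻¹ = a
  field_simp
  ring

lemma tendsto_sourceBound {s : ℕ → ℝ} {c : ℝ} (hc : 0 < c)
    (hs : ∀ᶠ N : ℕ in atTop, c * N ^ 2 ≤ s N)
    (hm : Tendsto (fun N : ℕ => (N : ℝ) / m N ^ 2) atTop (𝓝 0))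
    (hsm : Tendsto (fun N : ℕ => s N / (N * m N ^ 2)) atTop (𝓝 0))
    (hlog : Tendsto (fun N : ℕ => Real.log (1 + s N / 2) / N) atTop (𝓝 0)) :
    Tendsto (fun N => sourceBound N (m N) (s N)) atTop (𝓝 0) := by
  have hinv : Tendsto (fun N : ℕ => 1 / (N : ℝ)) atTop (𝓝 0) := tendsto_one_div_atTop_nhds_zero_nat
  have hlim := (((((hinv.const_mul (1 / c)).const_mul 128).add (hinv.const_mul 32)).add
    (hm.const_mul 32)).add (hsm.const_mul 8)).add (hlog.const_mul (32 * (4 * (1 / c) + 1)))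
    |>.const_mul 4
  simp only [mul_zero, add_zero] at hlim
  have hbounds : ∀ᶠ N : ℕ in atTop, 0 < N ∧ 0 < s N ∧ (N : ℝ) ^ 2 / s N ≤ 1 / c := by
    filter_upwards [hs, eventually_gt_atTop 0] with N hsN hN
    have hpos : 0 < s N := lt_of_lt_of_le (by positivity) hsN
    exact ⟨hN, hpos, by rw [div_le_div_iff₀ hpos hc]; linarith⟩
  refine squeeze_zero' ?_ ?_ hlim
  all_goals
    filter_upwards [hbounds] with N ⟨hN, hpos, hratio⟩
    have hlog_nonneg : 0 ≤ Real.log (1 + s N / 2) := Real.log_nonneg (by linarith)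
    rw [sourceBound_eq hN hpos]
  · positivity
  · have hinv : (N : ℝ) / s N ≤ 1 / c * (1 / N) := by
      calc (N : ℝ) / s N = N ^ 2 / s N * (1 / N) := by field_simp
        _ ≤ _ := by gcongr
    gcongr

lemma tendsto_rpow_div {p q : ℝ} (hpq : p < q) (t : ℝ) :
    Tendsto (fun N : ℕ => (N : ℝ) ^ p / ((N : ℝ) ^ q * t)) atTop (𝓝 0) := by
  have hdecay := ((tendsto_rpow_neg_atTop (sub_pos.2 hpq)).comp
    tendsto_natCast_atTop_atTop).div_const t
  rw [zero_div] at hdecay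
  refine hdecay.congr' ?_
  filter_upwards [eventually_gt_atTop 0] with N hN
  have hN' : (0 : ℝ) < N := by exact_mod_cast hN
  rw [Function.comp_apply, neg_sub, Real.rpow_sub hN', div_div]

lemma tendsto_log_one_add_rpow_div {p t : ℝ} (hp : 0 ≤ p) (ht : 0 ≤ t) :
    Tendsto (fun N : ℕ => Real.log (1 + (N : ℝ) ^ p * t) / N) atTop (𝓝 0) := by
  have hlog : Tendsto (fun N : ℕ => Real.log N / N) atTop (𝓝 0) :=
    Real.isLittleO_log_id_atTop.tendsto_div_nhds_zero.comp tendsto_natCast_atTop_atTop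
  have hlim : Tendsto (fun N : ℕ => Real.log (1 + t) / N + p * (Real.log N / N)) atTop (𝓝 0) := by
    simpa using (tendsto_const_div_atTop_nhds_zero_nat (Real.log (1 + t))).add (hlog.const_mul p)
  refine squeeze_zero' (.of_forall fun N => ?_) ?_ hlim
  · exact div_nonneg (Real.log_nonneg (by linarith [show 0 ≤ (N : ℝ) ^ p * t by positivity]))
      N.cast_nonneg
  · filter_upwards [eventually_gt_atTop 0] with N hN
    have hN' : (0 : ℝ) < N := by exact_mod_cast hN
    have hpow : 1 ≤ (N : ℝ) ^ p := Real.one_le_rpow (by exact_mod_cast hN) hp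
    rw [mul_div_assoc', ← add_div, ← Real.log_rpow hN', ← Real.log_mul (by positivity)
      (by positivity)]
    gcongr
    linarith

variable {α : ℝ}

lemma rpow_div_two_le_resSize (hα : 0 < 1 + α) :
    ∀ᶠ N : ℕ in atTop, (N : ℝ) ^ (1 + α) / 2 ≤ resSize α N := by
  filter_upwards [((tendsto_rpow_atTop hα).comp tendsto_natCast_atTop_atTop).eventually_ge_atTop 2]
    with N hN
  rw [Function.comp_apply] at hN
  calc (N : ℝ) ^ (1 + α) / 2 ≤ (N : ℝ) ^ (1 + α) - 1 := by linarith
    _ ≤ resSize α N := (Nat.sub_one_lt_floor _).le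

lemma tendsto_resSize (hα : 0 < 1 + α) : Tendsto (resSize α) atTop atTop :=
  tendsto_nat_floor_atTop.comp ((tendsto_rpow_atTop hα).comp tendsto_natCast_atTop_atTop)

lemma tendsto_div_resSize (hα : 0 < α) :
    Tendsto (fun N : ℕ => (N : ℝ) / resSize α N) atTop (𝓝 0) := by
  refine squeeze_zero' (.of_forall fun N => by positivity) ?_
    (tendsto_rpow_div (show 1 < 1 + α by linarith) (1 / 2))
  filter_upwards [rpow_div_two_le_resSize (show 0 < 1 + α by linarith), eventually_gt_atTop 0]
    with N hsize hN
  rw [Real.rpow_one]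
  gcongr
  linarith

lemma tendsto_rpow_div_resSize_sq {p t : ℝ} (hα : 0 < 1 + α) (hp : p < 3 + 2 * α) (ht : 0 ≤ t) :
    Tendsto (fun N : ℕ => (N : ℝ) ^ p * t / (N * resSize α N ^ 2)) atTop (𝓝 0) := by
  have hlim := (tendsto_rpow_div hp (1 / 4)).mul_const t
  rw [zero_mul] at hlim
  refine squeeze_zero' (.of_forall fun N => by positivity) ?_ hlim
  filter_upwards [rpow_div_two_le_resSize hα, eventually_gt_atTop 0] with N hsize hN
  have hN' : (0 : ℝ) < N := by exact_mod_cast hN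
  have hpow : (N : ℝ) ^ (3 + 2 * α) * (1 / 4) = N * ((N : ℝ) ^ (1 + α) / 2) ^ 2 := by
    rw [show 3 + 2 * α = 1 + (1 + α) + (1 + α) by ring, Real.rpow_add hN', Real.rpow_add hN',
      Real.rpow_one]
    ring
  rw [hpow, div_mul_eq_mul_div]
  gcongr

lemma tendsto_sourceBound_resSize {α' t : ℝ} (hα : 0 < α) (hα' : 0 ≤ α') (hαα' : α' < 1 + 2 * α)
    (ht : 0 < t) :
    Tendsto (fun N : ℕ => sourceBound N (resSize α N) ((N : ℝ) ^ (2 + α') * t)) atTop (𝓝 0) := by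
  have hα₁ : 0 < 1 + α := by linarith
  refine tendsto_sourceBound ht ?_ ?_ (tendsto_rpow_div_resSize_sq hα₁ (by linarith) ht.le) ?_
  · filter_upwards [eventually_ge_atTop 1] with N hN
    rw [mul_comm, ← Real.rpow_two]
    gcongr
    · exact_mod_cast hN
    · linarith
  · refine squeeze_zero' (.of_forall fun N => by positivity) ?_ (tendsto_div_resSize hα)
    filter_upwards [(tendsto_resSize hα₁).eventually_gt_atTop 0] with N hM
    gcongr
    exact le_self_pow₀ (by exact_mod_cast hM) two_ne_zero
  · simpa only [mul_div_assoc] using tendsto_log_one_add_rpow_div (p := 2 + α') (t := t / 2)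
      (by linarith) (by positivity)

/-- Bound for the part of the correlations at time `s` that does not come from the initial
correlations inside the channel; `v` are the limits of the reservoir densities. -/
def correlationError (μ : Config N M → ℝ) (v : Side → ℝ) (s : ℝ) : ℝ :=
  ∑ σ, reservoirError μ σ (v σ) + N / M + sourceBound N M s

lemma tendsto_correlationError {α' t : ℝ} (hα : 0 < α) (hα' : 0 ≤ α') (hαα' : α' < 1 + 2 * α)
    (ht : 0 < t) {μ : (N : ℕ) → Config N (resSize α N) → ℝ}
    (hμ : ∀ N, μ N ∈ stdSimplex ℝ (Config N (resSize α N))) {v : Side → ℝ}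
    (hv : ∀ σ : Side, ∀ δ > 0, Tendsto
      (fun N => prob (μ N) fun ω => δ < |reservoirDensity (σ.particles ω) - v σ|) atTop (𝓝 0)) :
    Tendsto (fun N : ℕ => correlationError (μ N) v ((N : ℝ) ^ (2 + α') * t)) atTop (𝓝 0) := by
  have hreservoir := tendsto_finsetSum Finset.univ fun σ _ =>
    tendsto_reservoirError (tendsto_resSize (by linarith)) hμ (hv σ)
  simpa [correlationError] using (hreservoir.add (tendsto_div_resSize hα)).add
    (tendsto_sourceBound_resSize hα hα' hαα' ht)

lemma exitTime_mem_Icc {x : ℕ} (hx : x ∈ Finset.Icc 1 N) :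
    exitTime N x ∈ Set.Icc (0 : ℝ) (x * N) := by
  have h1 : (1 : ℝ) ≤ x := by exact_mod_cast (Finset.mem_Icc.1 hx).1
  have h2 : (x : ℝ) ≤ N := by exact_mod_cast (Finset.mem_Icc.1 hx).2
  exact ⟨mul_nonneg (by linarith) (by linarith),
    mul_le_mul_of_nonneg_left (by linarith) (by linarith)⟩

lemma abs_correlation_le_correlationError_add {μ : Config N M → ℝ} (hN : 0 < N) (hM : 2 ≤ M)
    (hμ : μ ∈ stdSimplex ℝ (Config N M)) (v : Side → ℝ) {s : ℝ} (hs : 0 < s) {x y : ℕ}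
    (hx : x ∈ Finset.Icc 1 N) (hy : y ∈ Finset.Icc 1 N) (hxy : x ≠ y) :
    |correlation μ s x y| ≤ correlationError μ v s + (x + y) / 2 * (N / s) := by
  have h := abs_correlation_le hN hM hμ (reservoirError_le_sum hM hμ.1 v)
    le_rfl one_half_pos.le (fun x y _ => by simpa using abs_correlation_zero_le_one hμ x y) hs
    (x := ⟨x, hx⟩) (y := ⟨y, hy⟩) (by simpa using hxy)
  have hexit : (exitTime N x + exitTime N y) / s ≤ (x * N + y * N) / s := by
    gcongr
    exacts [(exitTime_mem_Icc hx).2, (exitTime_mem_Icc hy).2]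
  calc _ ≤ _ := h
    _ ≤ 0 + ∑ σ, reservoirError μ σ (v σ) + 1 / 2 * (2 * (N / M) + (x * N + y * N) / s)
        + sourceBound N M s := by gcongr
    _ = _ := by rw [correlationError]; ring

lemma abs_correlation_le_add_correlationError {μ : Config N M → ℝ} (hN : 0 < N) (hM : 2 ≤ M)
    (hμ : μ ∈ stdSimplex ℝ (Config N M)) (v : Side → ℝ) {s : ℝ} (hs : 0 < s) {ε : ℝ} (hε : 0 ≤ ε)
    (h0 : ∀ x ∈ Finset.Icc 1 N, ∀ y ∈ Finset.Icc 1 N, x ≠ y → |correlation μ 0 x y| ≤ ε) {x y : ℕ}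
    (hx : x ∈ Finset.Icc 1 N) (hy : y ∈ Finset.Icc 1 N) (hxy : x ≠ y) :
    |correlation μ s x y| ≤ ε + correlationError μ v s := by
  have h := abs_correlation_le hN hM hμ (reservoirError_le_sum hM hμ.1 v)
    hε le_rfl (fun x y hxy => by simpa using h0 x x.2 y y.2 (Subtype.coe_ne_coe.2 hxy)) hs
    (x := ⟨x, hx⟩) (y := ⟨y, hy⟩) (by simpa using hxy)
  rw [correlationError]
  linarith [show (0 : ℝ) ≤ N / M by positivity]

section Decorrelation

variable {v : Side → ℝ} {s : ℕ → ℝ}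

lemma tendsto_abs_correlation (hm : Tendsto m atTop atTop)
    (hμ : ∀ N, μ N ∈ stdSimplex ℝ (Config N (m N))) (hs : ∀ᶠ N in atTop, 0 < s N)
    (herror : Tendsto (fun N => correlationError (μ N) v (s N)) atTop (𝓝 0))
    (hexit : Tendsto (fun N => N / s N) atTop (𝓝 0)) {x y : ℕ} (hx : 1 ≤ x) (hy : 1 ≤ y)
    (hxy : x ≠ y) : Tendsto (fun N => |correlation (μ N) (s N) x y|) atTop (𝓝 0) := by
  have hlim := herror.add (hexit.const_mul (((x : ℝ) + y) / 2))
  rw [mul_zero, add_zero] at hlim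
  refine squeeze_zero' (.of_forall fun N => abs_nonneg _) ?_ hlim
  filter_upwards [hs, hm.eventually_ge_atTop 2, eventually_ge_atTop x, eventually_ge_atTop y]
    with N hs hM hxN hyN
  exact abs_correlation_le_correlationError_add (by lia) hM (hμ N) v hs
    (Finset.mem_Icc.2 ⟨hx, hxN⟩) (Finset.mem_Icc.2 ⟨hy, hyN⟩) hxy

variable {μ : (N : ℕ) → Config N (resSize α N) → ℝ}

lemma uniformlyDecorrelated_of_tendsto_sq_div (hm : Tendsto (resSize α) atTop atTop)
    (hμ : ∀ N, μ N ∈ stdSimplex ℝ (Config N (resSize α N))) (hs : ∀ᶠ N in atTop, 0 < s N)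
    (herror : Tendsto (fun N => correlationError (μ N) v (s N)) atTop (𝓝 0))
    (hexit : Tendsto (fun N : ℕ => (N : ℝ) ^ 2 / s N) atTop (𝓝 0)) :
    UniformlyDecorrelated α μ s := by
  intro ε hε
  have hlim := herror.add hexit
  rw [add_zero] at hlim
  filter_upwards [hs, hm.eventually_ge_atTop 2, hlim.eventually_lt_const hε]
    with N hs hM hlt x hx y hy hxy
  obtain ⟨hx₁, hxN⟩ := Finset.mem_Icc.1 hx
  have hxy_le : ((x : ℝ) + y) / 2 ≤ N := by
    have hxN' : (x : ℝ) ≤ N := by exact_mod_cast hxN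
    have hyN' : (y : ℝ) ≤ N := by exact_mod_cast (Finset.mem_Icc.1 hy).2
    linarith
  calc |correlation (μ N) (s N) x y|
      ≤ correlationError (μ N) v (s N) + (x + y) / 2 * (N / s N) :=
        abs_correlation_le_correlationError_add (by lia) hM (hμ N) v hs hx hy hxy
    _ ≤ correlationError (μ N) v (s N) + N * (N / s N) := by gcongr
    _ < ε := by rwa [← mul_div_assoc, ← sq]

lemma UniformlyDecorrelated.of_initial (h0 : UniformlyDecorrelated α μ fun _ => 0)
    (hm : Tendsto (resSize α) atTop atTop)
    (hμ : ∀ N, μ N ∈ stdSimplex ℝ (Config N (resSize α N))) (hs : ∀ᶠ N in atTop, 0 < s N)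
    (herror : Tendsto (fun N => correlationError (μ N) v (s N)) atTop (𝓝 0)) :
    UniformlyDecorrelated α μ s := by
  intro ε hε
  filter_upwards [hs, hm.eventually_ge_atTop 2, h0 _ (half_pos hε), eventually_gt_atTop 0,
    herror.eventually_lt_const (half_pos hε)] with N hs hM h0 hN hlt x hx y hy hxy
  linarith [abs_correlation_le_add_correlationError hN hM (hμ N) v hs (half_pos hε).le
    (fun x hx y hy hxy => (h0 x hx y hy hxy).le) hx hy hxy]

end Decorrelation

end Asymptotics

end ReservoirSSEP

end

open ReservoirSSEP

theorem mainTheorem3_general (α α' : ℝ) (hα : 0 < α) (hα' : 0 ≤ α') (hαα' : α' < 1 + 2 * α)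
    (vm vp : ℝ) (μ : (N : ℕ) → Config N (resSize α N) → ℝ)
    (hμ : ∀ N, μ N ∈ stdSimplex ℝ (Config N (resSize α N)))
    (hleft : ∀ δ > 0,
      Tendsto (fun N => prob (μ N) fun ω => δ < |leftDensity ω - vm|) atTop (𝓝 0))
    (hright : ∀ δ > 0,
      Tendsto (fun N => prob (μ N) fun ω => δ < |rightDensity ω - vp|) atTop (𝓝 0))
    (t : ℝ) (ht : 0 < t) :
    (∀ x₁ x₂ : ℕ, 1 ≤ x₁ → 1 ≤ x₂ → x₁ ≠ x₂ →
      Tendsto (fun N : ℕ => |correlation (μ N) ((N : ℝ) ^ (2 + α') * t) x₁ x₂|) atTop (𝓝 0)) ∧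
    (0 < α' ∨ UniformlyDecorrelated α μ (fun _ => 0) →
      UniformlyDecorrelated α μ (fun N => (N : ℝ) ^ (2 + α') * t)) := by
  have hm := tendsto_resSize (show 0 < 1 + α by linarith)
  have hs : ∀ᶠ N : ℕ in atTop, 0 < (N : ℝ) ^ (2 + α') * t := by
    filter_upwards [eventually_gt_atTop 0] with N hN
    positivity
  have herror := tendsto_correlationError (v := fun | .left => vm | .right => vp) hα hα' hαα' ht hμ
    fun | .left => hleft | .right => hright
  refine ⟨fun x₁ x₂ hx₁ hx₂ hx₁₂ => ?_, fun h => h.elim (fun hα'_pos => ?_) fun h0 => ?_⟩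
  · have hexit := tendsto_rpow_div (show 1 < 2 + α' by linarith) t
    simp only [Real.rpow_one] at hexit
    exact tendsto_abs_correlation hm hμ hs herror hexit hx₁ hx₂ hx₁₂
  · have hexit := tendsto_rpow_div (show 2 < 2 + α' by linarith) t
    simp only [Real.rpow_two] at hexit
    exact uniformlyDecorrelated_of_tendsto_sq_div hm hμ hs herror hexit
  · exact h0.of_initial hm hμ hs herror

theorem mainTheorem3 (α α' : ℝ) (hα : 0 < α) (hα' : 0 ≤ α') (hαα' : α' < α)
    (u₀ : ℝ → ℝ) (hu₀ : ContinuousOn u₀ (Set.Ioo 0 1))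
    (hu₀_mem : ∀ r ∈ Set.Ioc (0 : ℝ) 1, u₀ r ∈ Set.Icc (0 : ℝ) 1)
    (vm vp : ℝ) (hvm : vm ∈ Set.Icc (0 : ℝ) 1) (hvp : vp ∈ Set.Icc (0 : ℝ) 1)
    (μ : (N : ℕ) → ReservoirSSEP.Config N (ReservoirSSEP.resSize α N) → ℝ)
    (hμ : ReservoirSSEP.InitialAssumption α u₀ vm vp μ)
    (t : ℝ) (ht : 0 < t) :
    (∀ x₁ x₂ : ℕ, 1 ≤ x₁ → 1 ≤ x₂ → x₁ ≠ x₂ →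
      Tendsto (fun N : ℕ =>
        |ReservoirSSEP.correlation (μ N) ((N : ℝ) ^ (2 + α') * t) x₁ x₂|) atTop (𝓝 0)) ∧
    (0 < α' ∨ ReservoirSSEP.UniformlyDecorrelated α μ (fun _ => 0) →
      ReservoirSSEP.UniformlyDecorrelated α μ (fun N => (N : ℝ) ^ (2 + α') * t)) :=
  mainTheorem3_general α α' hα hα' (by linarith) vm vp μ hμ.isProb hμ.left_tendsto
    hμ.right_tendsto t ht
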